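/- Theorem (Asynchronous incremental voting on $K_n$). Consider the following process on the complete graph $K_n$: each vertex holds an integer opinion, and at each step a vertex $v$ is chosen uniformly at random, then one of its $n-1$ neighbours $w$ is chosen uniformly at random, all choices at different steps being independent; the opinion of $v$ moves by $1$ towards the opinion of $w$ (and does not change if the two are equal), and all other opinions stay the same. Opinion $j$ *wins* if at some time all vertices hold opinion $j$; the *completion time* is the first time at which all vertices hold the same opinion. There is an absolute constant $C>0$ such that the following holds. For every $n$ let the initial opinions of the vertices of $K_n$ be arbitrary elements of $\{1,\dots,k\}$, where $k=k(n)=o(n/(\log n)^2)$, and let $c=c(n)$ be the average of the initial opinions. All asymptotics are for $n\to\infty$, and $i=i(n)$ denotes an integer, which may depend on $n$. (i) Suppose that $i<c<i+1$ for all large $n$. Then $\mathbb P(i\text{ wins})=i+1-c+o(1)$ and $\mathbb P(i+1\text{ wins})=c-i+o(1)$. Consequently $\mathbb P(i\text{ wins})\sim i+1-c$ if $i+1-c$ is bounded away from $0$, and $\mathbb P(i+1\text{ wins})\sim c-i$ if $c-i$ is bounded away from $0$; in particular both relations hold if $c-i$ is a constant in $(0,1)$. If $c=i+o(1)$, then $\mathbb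 P(i\text{ wins})\sim 1$. (ii) With probability $1-o(1)$, after some number of steps that is at most $C\,nk\log n$, all opinions lie in a set $\{j-1,j,j+1\}$ of three consecutive integers. For all sufficiently large $n$, the expected completion time is at most $C n^2$. -/

import Mathlib

open Filter Topology MeasureTheory Asymptotics
open scoped ENNReal

namespace IncrementalVoting

/-- The incremental update of an opinion `a` whose holder observes the opinion `b`: it moves by one
towards `b`, and stays unchanged if `a = b`. -/
def nudge (a b : ℤ) : ℤ :=
  if a < b then a + 1 else if b < a then a - 1 else a

/-- One asynchronous step: the vertex `e.1` observes the vertex `e.2` and updates its opinion; all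
the other opinions are unchanged. -/
def step {V : Type*} [DecidableEq V] (X : V → ℤ) (e : V × V) : V → ℤ :=
  Function.update X e.1 (nudge (X e.1) (X e.2))

/-- The vector of opinions after `t` steps, from the initial opinions `x₀`, when the selections made
at the successive steps are `ω 0, ω 1, ω 2, …`. -/
def opinions {V : Type*} [DecidableEq V] (x₀ : V → ℤ) (ω : ℕ → V × V) : ℕ → V → ℤ
  | 0 => x₀
  | t + 1 => step (opinions x₀ ω t) (ω t)

/-- The law of the selection `(v, w)` of one step of the asynchronous vertex process on `G`: the
vertex `v` is uniform over all vertices, and then `w` is uniform over the neighbours of `v`.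
(An isolated vertex, which has no neighbour, observes itself.) -/
noncomputable def selection {V : Type*} [Fintype V] [Nonempty V] (G : SimpleGraph V)
    [DecidableRel G.Adj] : PMF (V × V) :=
  open Classical in
  (PMF.uniformOfFintype V).bind fun v =>
    if hv : (G.neighborFinset v).Nonempty then
      (PMF.uniformOfFinset (G.neighborFinset v) hv).map fun w => (v, w)
    else PMF.pure (v, v)

/-- The law of the sequence of selections of the asynchronous vertex process on `G`: the selections
of the different steps are independent and distributed as `selection G`. (Without vertices nothing
can be selected; the sample space is then empty and carries the zero measure.) -/
noncomputable def law {V : Type*} [Fintype V] [MeasurableSpace V] (G : SimpleGraph V)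
    [DecidableRel G.Adj] : Measure (ℕ → V × V) :=
  open Classical in
  if _h : Nonempty V then Measure.infinitePi fun _ : ℕ => (selection G).toMeasure else 0

/-- The law of the selections of the asynchronous vertex process on the complete graph `K_n`. -/
noncomputable def completeLaw (n : ℕ) : Measure (ℕ → Fin n × Fin n) :=
  law (⊤ : SimpleGraph (Fin n))

/-- The average of the opinions `x` of `n` vertices. -/
noncomputable def average {n : ℕ} (x : Fin n → ℤ) : ℝ :=
  (∑ v, (x v : ℝ)) / n

/-- The probability that, in the asynchronous vertex process on `K_n` with initial opinions `x`,
opinion `i` wins, that is, at some time all vertices hold opinion `i`. -/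
noncomputable def winProb {n : ℕ} (x : Fin n → ℤ) (i : ℤ) : ℝ :=
  (completeLaw n).real {ω | ∃ t, ∀ v, opinions x ω t v = i}

/-- All opinions in `X` are among three consecutive integers. -/
def AtMostThreeConsecutive {V : Type*} (X : V → ℤ) : Prop :=
  ∃ j : ℤ, ∀ v, X v = j - 1 ∨ X v = j ∨ X v = j + 1

/-- The first time at which all vertices hold the same opinion (`∞` if there is none). -/
noncomputable def completionTime {V : Type*} [DecidableEq V] (x₀ : V → ℤ) (ω : ℕ → V × V) : ℝ≥0∞ :=
  ⨅ (t : ℕ) (_ : ∀ v w, opinions x₀ ω t v = opinions x₀ ω t w), (t : ℝ≥0∞)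

end IncrementalVoting

namespace IncrementalVoting

/-! Everything is expressed through the one-step averaging operator $P$ = `transition n`:
`integral_opinions` identifies $\mathbb E\,g(X_t)$ with $P^t g$ for bounded $g$, and probabilities
are bounded by comparing functions under powers of $P$ on sets the process cannot leave.

Ordered pairs are equally likely and the moves of $v$ towards $w$ and of $w$ towards $v$ are
opposite, so the sum $S$ of the opinions is a martingale with steps at most $1$. In $t=o(n^2)$ steps
it moves by $o(n)$ in mean square, hence the average by $o(1)$
(`transition_pow_opinionSum_sub_sq_le`). In that time the range collapses: the product of the
numbers of holders of the smallest and largest admissible values contracts by $1-1/n$ per step while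
at least four values are admissible (`transition_extremes_le`). After about $4n\log n$ steps one of
the two has died out with high probability, and at most $k$ such phases leave three values.

One further phase makes the product $AD$ of the outer counts of three values at most of order
$(\delta n)^2$ in expectation (`transition_pow_extremes_three_le`). As the average is still near
$c\in[i,i+1]$, the total distance of the opinions from $\{i,i+1\}$ is then $o(n)$ in expectation
(`totalGap_le`). This distance is a supermartingale, so it stays small until consensus. There the
indicator of the winner differs from an affine function of the opinion by at most twice its distance
from $\{i,i+1\}$, and the martingale property gives the winning probabilities
(`abs_winProb_sub_le`).

The completion time is bounded by Foster's criterion. With two values, the potential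
$n\,a(1+H_n-H_a)$, summed over the two counts, decreases by at least $1$ per step on average before
consensus. With three values the same holds for a multiple of $3-2/\sqrt{AD}$ plus a constant
(`transition_threePotential_le`). Restarting after the collapse of the range extends the bound to
all initial opinions. -/

/-! ### The transition operator and comparison of its iterates -/

/-- The probability that the selection made at one step on `K_n` is `(v, w)`. -/
noncomputable def weight {n : ℕ} (v w : Fin n) : ℝ :=
  if v = w then 0 else 1 / ((n : ℝ) * (n - 1))

/-- The transition operator of the vector of opinions on `K_n`. -/
noncomputable def transition (n : ℕ) :
    Module.End ℝ ((Fin n → ℤ) → ℝ) where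
  toFun g x := ∑ v, ∑ w, weight v w * g (step x (v, w))
  map_add' g h := by
    funext x
    simp [mul_add, Finset.sum_add_distrib]
  map_smul' a g := by
    funext x
    simp only [Pi.smul_apply, smul_eq_mul, RingHom.id_apply, Finset.mul_sum]
    exact Finset.sum_congr rfl fun v _ => Finset.sum_congr rfl fun w _ => by ring

lemma transition_apply {n : ℕ} (g : (Fin n → ℤ) → ℝ) (x : Fin n → ℤ) :
    transition n g x = ∑ v, ∑ w, weight v w * g (step x (v, w)) := rfl

lemma weight_nonneg {n : ℕ} (v w : Fin n) : 0 ≤ weight v w := by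
  unfold weight
  split_ifs
  · exact le_rfl
  · have : (1 : ℝ) ≤ n := by exact_mod_cast v.pos
    have : (0 : ℝ) ≤ n - 1 := by linarith
    positivity

lemma sum_weight {n : ℕ} (hn : 2 ≤ n) : ∑ v : Fin n, ∑ w : Fin n, weight v w = 1 := by
  have h2 : (2 : ℝ) ≤ n := by exact_mod_cast hn
  have h : ∀ v : Fin n, ∑ w : Fin n, weight v w = 1 / n := by
    intro v
    have h1 : ∀ w : Fin n, weight v w =
        1 / ((n : ℝ) * (n - 1)) - if v = w then 1 / ((n : ℝ) * (n - 1)) else 0 := by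
      intro w
      unfold weight
      split_ifs <;> simp
    rw [Finset.sum_congr rfl fun w _ => h1 w, Finset.sum_sub_distrib]
    simp only [Finset.sum_const, Finset.card_univ, Fintype.card_fin, Finset.sum_ite_eq,
      Finset.mem_univ, if_true, nsmul_eq_mul]
    have : (n : ℝ) - 1 ≠ 0 := by linarith
    field_simp
  rw [Finset.sum_congr rfl fun v _ => h v]
  simp only [Finset.sum_const, Finset.card_univ, Fintype.card_fin, nsmul_eq_mul]
  field_simp

lemma nudge_self (a : ℤ) : nudge a a = a := by simp [nudge]

lemma step_self {V : Type*} [DecidableEq V] (x : V → ℤ) (v : V) : step x (v, v) = x := by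
  simp [step, nudge_self]

/-- The drift of `g` as a sum over all pairs: the pairs `(v, v)` contribute zero. -/
lemma transition_sub_self {n : ℕ} (hn : 2 ≤ n) (g : (Fin n → ℤ) → ℝ) (x : Fin n → ℤ) :
    transition n g x - g x =
      (∑ v, ∑ w, (g (step x (v, w)) - g x)) / ((n : ℝ) * (n - 1)) := by
  have h : g x = ∑ v : Fin n, ∑ w : Fin n, weight v w * g x := by
    simp_rw [← Finset.sum_mul]
    rw [sum_weight hn, one_mul]
  have h' : transition n g x - g x =
      ∑ v, ∑ w, weight v w * g (step x (v, w)) - ∑ v : Fin n, ∑ w : Fin n, weight v w * g x := by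
    rw [← h, transition_apply]
  rw [h', ← Finset.sum_sub_distrib, Finset.sum_div]
  refine Finset.sum_congr rfl fun v _ => ?_
  rw [← Finset.sum_sub_distrib, Finset.sum_div]
  refine Finset.sum_congr rfl fun w _ => ?_
  rw [← mul_sub]
  by_cases hvw : v = w
  · subst hvw
    simp [step_self]
  · rw [weight, if_neg hvw]
    ring

lemma transition_const {n : ℕ} (hn : 2 ≤ n) (a : ℝ) :
    transition n (fun _ => a) = fun _ => a := by
  funext x
  rw [transition_apply]
  simp_rw [← Finset.sum_mul]
  rw [sum_weight hn, one_mul]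

lemma transition_pow_const {n : ℕ} (hn : 2 ≤ n) (a : ℝ) (t : ℕ) :
    (transition n ^ t) (fun _ => a) = fun _ => a := by
  induction t with
  | zero => rfl
  | succ t ih => rw [pow_succ, Module.End.mul_apply, transition_const hn, ih]

/-- A set of opinion vectors that the process cannot leave. -/
def Invariant {n : ℕ} (I : (Fin n → ℤ) → Prop) : Prop :=
  ∀ x, I x → ∀ e, I (step x e)

/-- The operator only averages over successors of `x`, so an inequality on an invariant set
suffices. Estimates that fail for general opinion vectors can thus be used on a bounded range of
opinions. -/
lemma transition_mono {n : ℕ} {I : (Fin n → ℤ) → Prop} (hI : Invariant I)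
    {g h : (Fin n → ℤ) → ℝ} (hgh : ∀ x, I x → g x ≤ h x) {x : Fin n → ℤ} (hx : I x) :
    transition n g x ≤ transition n h x := by
  rw [transition_apply, transition_apply]
  exact Finset.sum_le_sum fun v _ => Finset.sum_le_sum fun w _ =>
    mul_le_mul_of_nonneg_left (hgh _ (hI x hx _)) (weight_nonneg v w)

lemma transition_pow_mono {n : ℕ} {I : (Fin n → ℤ) → Prop} (hI : Invariant I)
    {g h : (Fin n → ℤ) → ℝ} (hgh : ∀ x, I x → g x ≤ h x) (t : ℕ) :
    ∀ x, I x → (transition n ^ t) g x ≤ (transition n ^ t) h x := by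
  induction t with
  | zero => exact hgh
  | succ t ih =>
    intro x hx
    rw [pow_succ', Module.End.mul_apply, Module.End.mul_apply]
    exact transition_mono hI ih hx

/-- Geometric decay of a function that is contracted by the transition operator. -/
lemma transition_pow_le_of_contracting {n : ℕ} {I : (Fin n → ℤ) → Prop} (hI : Invariant I)
    {g : (Fin n → ℤ) → ℝ} {a : ℝ} (ha : 0 ≤ a) (hg : ∀ x, I x → transition n g x ≤ a * g x)
    (t : ℕ) : ∀ x, I x → (transition n ^ t) g x ≤ a ^ t * g x := by
  induction t with
  | zero => intro x _; simp
  | succ t ih =>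
    intro x hx
    rw [pow_succ', Module.End.mul_apply]
    calc transition n ((transition n ^ t) g) x
        ≤ transition n (a ^ t • g) x := transition_mono hI ih hx
      _ = a ^ t * transition n g x := by rw [map_smul]; rfl
      _ ≤ a ^ t * (a * g x) := mul_le_mul_of_nonneg_left (hg x hx) (pow_nonneg ha t)
      _ = a ^ (t + 1) * g x := by ring

/-- Foster's criterion: a potential that decreases on average by `f` bounds the accumulated
expectation of `f`. -/
lemma sum_transition_pow_le_of_drift {n : ℕ} {I : (Fin n → ℤ) → Prop} (hI : Invariant I)
    {f g : (Fin n → ℤ) → ℝ} (hg0 : ∀ x, I x → 0 ≤ g x)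
    (hg : ∀ x, I x → transition n g x ≤ g x - f x) (N : ℕ) :
    ∀ x, I x → ∑ t ∈ Finset.range N, (transition n ^ t) f x ≤ g x := by
  induction N with
  | zero => intro x hx; simpa using hg0 x hx
  | succ N ih =>
    intro x hx
    rw [Finset.sum_range_succ']
    have h : ∑ t ∈ Finset.range N, (transition n ^ (t + 1)) f x ≤ transition n g x := by
      have h1 : ∑ t ∈ Finset.range N, (transition n ^ (t + 1)) f x =
          transition n (fun y => ∑ t ∈ Finset.range N, (transition n ^ t) f y) x := by
        have h2 : (fun y => ∑ t ∈ Finset.range N, (transition n ^ t) f y) =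
            ∑ t ∈ Finset.range N, (transition n ^ t) f := by
          funext y; simp
        rw [h2, map_sum, Finset.sum_apply]
        simp_rw [pow_succ', Module.End.mul_apply]
      rw [h1]
      exact transition_mono hI ih hx
    have h0 : (transition n ^ 0) f x = f x := by simp
    linarith [hg x hx]

/-! ### The law of the process -/

lemma selection_apply {n : ℕ} (hn : 2 ≤ n) [Nonempty (Fin n)] (e : Fin n × Fin n) :
    (selection (⊤ : SimpleGraph (Fin n)) e).toReal = weight e.1 e.2 := by
  classical
  have hcard : ∀ v : Fin n, ((⊤ : SimpleGraph (Fin n)).neighborFinset v).card = n - 1 := by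
    intro v
    rw [SimpleGraph.card_neighborFinset_eq_degree, SimpleGraph.complete_graph_degree,
      Fintype.card_fin]
  have hne : ∀ v : Fin n, ((⊤ : SimpleGraph (Fin n)).neighborFinset v).Nonempty := by
    intro v
    rw [← Finset.card_pos, hcard]
    omega
  obtain ⟨a, b⟩ := e
  have hn1 : ((n - 1 : ℕ) : ℝ) = (n : ℝ) - 1 := by
    rw [Nat.cast_sub (by omega)]; simp
  unfold selection
  rw [PMF.bind_apply, tsum_fintype, Finset.sum_eq_single a]
  · rw [dif_pos (hne a), PMF.map_apply, tsum_fintype, Finset.sum_eq_single b]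
    · simp only [if_true, PMF.uniformOfFintype_apply, PMF.uniformOfFinset_apply, Fintype.card_fin,
        SimpleGraph.mem_neighborFinset, SimpleGraph.top_adj, weight, hcard]
      by_cases hab : a = b
      · simp [hab]
      · rw [if_pos hab, if_neg hab]
        rw [ENNReal.toReal_mul, ENNReal.toReal_inv, ENNReal.toReal_inv, ENNReal.toReal_natCast,
          ENNReal.toReal_natCast, hn1]
        rw [one_div, mul_inv]
    · intro c _ hc
      rw [if_neg]
      simpa using hc.symm
    · simp
  · intro v _ hv
    rw [dif_pos (hne v), PMF.map_apply]
    rw [mul_eq_zero]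
    right
    rw [ENNReal.tsum_eq_zero]
    intro c
    rw [if_neg]
    simp [hv.symm]
  · simp

lemma completeLaw_eq {n : ℕ} [Nonempty (Fin n)] : completeLaw n =
    Measure.infinitePi fun _ : ℕ => (selection (⊤ : SimpleGraph (Fin n))).toMeasure := by
  unfold completeLaw law
  rw [dif_pos]

lemma isProbabilityMeasure_completeLaw {n : ℕ} (hn : 2 ≤ n) :
    IsProbabilityMeasure (completeLaw n) := by
  have : Nonempty (Fin n) := ⟨⟨0, by omega⟩⟩
  rw [completeLaw_eq]
  infer_instance

lemma measurable_opinions {n : ℕ} (x : Fin n → ℤ) (t : ℕ) :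
    Measurable fun ω : ℕ → Fin n × Fin n => opinions x ω t := by
  induction t with
  | zero => exact measurable_const
  | succ t ih =>
    have h : Measurable fun p : (Fin n → ℤ) × (Fin n × Fin n) => step p.1 p.2 :=
      measurable_of_countable _
    exact h.comp (ih.prodMk (measurable_pi_apply t))

lemma opinions_congr {V : Type*} [DecidableEq V] (x : V → ℤ) {ω ω' : ℕ → V × V} {t : ℕ}
    (h : ∀ s < t, ω s = ω' s) : opinions x ω t = opinions x ω' t := by
  induction t with
  | zero => rfl
  | succ t ih =>
    rw [opinions, opinions, ih fun s hs => h s (by omega), h t (by omega)]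

/-- The opinions at time `t` are a function of the selections before `t`, which are independent of
selection `t`. -/
lemma indepFun_opinions {n : ℕ} [Nonempty (Fin n)] (x : Fin n → ℤ) (t : ℕ) :
    ProbabilityTheory.IndepFun (fun ω : ℕ → Fin n × Fin n => opinions x ω t) (fun ω => ω t)
      (completeLaw n) := by
  rw [completeLaw_eq]
  set P : ℕ → Measure (Fin n × Fin n) := fun _ =>
    (selection (⊤ : SimpleGraph (Fin n))).toMeasure
  have h := (ProbabilityTheory.iIndepFun_infinitePi (P := P) (X := fun _ e => e)
    (fun _ => measurable_id)).indepFun_finset (Finset.range t) {t} (by simp)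
    (fun i => measurable_pi_apply i)
  -- The values filled in from time `t` on are arbitrary; by `opinions_congr` they do not affect the
  -- opinions at time `t`.
  let ext : (Finset.range t → Fin n × Fin n) → ℕ → Fin n × Fin n := fun η s =>
    if hs : s ∈ Finset.range t then η ⟨s, hs⟩ else Classical.arbitrary _
  have hext : Measurable ext := by
    refine measurable_pi_lambda _ fun s => ?_
    by_cases hs : s ∈ Finset.range t
    · simp only [ext, dif_pos hs]
      exact measurable_pi_apply _
    · simp only [ext, dif_neg hs]
      exact measurable_const
  have hev : Measurable fun η : ({t} : Finset ℕ) → Fin n × Fin n =>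
      η ⟨t, Finset.mem_singleton_self t⟩ := measurable_pi_apply _
  have h' := h.comp (φ := fun η => opinions x (ext η) t)
    (ψ := fun η => η ⟨t, Finset.mem_singleton_self t⟩)
    ((measurable_opinions x t).comp hext) hev
  have h1 : (fun ω : ℕ → Fin n × Fin n => opinions x ω t) =
      (fun η => opinions x (ext η) t) ∘ fun ω (i : Finset.range t) => ω i := by
    funext ω
    refine opinions_congr x fun s hs => ?_
    simp [ext, hs]
  rw [h1]
  exact h'

/-- The expectation of a bounded function of the opinions at time `t` is an iterate of the
transition operator. -/
lemma integral_opinions {n : ℕ} (hn : 2 ≤ n) (x : Fin n → ℤ) (t : ℕ) :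
    ∀ (g : (Fin n → ℤ) → ℝ) (K : ℝ), (∀ y, |g y| ≤ K) →
      ∫ ω, g (opinions x ω t) ∂(completeLaw n) = (transition n ^ t) g x := by
  have : Nonempty (Fin n) := ⟨⟨0, by omega⟩⟩
  have := isProbabilityMeasure_completeLaw hn
  induction t with
  | zero => intro g K _; simp [opinions]
  | succ t ih =>
    intro g K hK
    rw [pow_succ, Module.End.mul_apply, ← ih (transition n g) K]
    · have hmo := measurable_opinions x t
      have hmt : Measurable fun ω : ℕ → Fin n × Fin n => ω t := measurable_pi_apply t
      have hmap := (ProbabilityTheory.indepFun_iff_map_prod_eq_prod_map_map hmo.aemeasurable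
        hmt.aemeasurable).1 (indepFun_opinions x t)
      have hsel : (completeLaw n).map (fun ω => ω t) =
          (selection (⊤ : SimpleGraph (Fin n))).toMeasure := by
        rw [completeLaw_eq]
        exact Measure.infinitePi_map_eval _ t
      have hG : Measurable fun p : (Fin n → ℤ) × (Fin n × Fin n) => g (step p.1 p.2) :=
        measurable_of_countable _
      have := Measure.isProbabilityMeasure_map (μ := completeLaw n) hmo.aemeasurable
      have hint : Integrable (fun p : (Fin n → ℤ) × (Fin n × Fin n) => g (step p.1 p.2))
          (((completeLaw n).map fun ω => opinions x ω t).prod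
            (selection (⊤ : SimpleGraph (Fin n))).toMeasure) :=
        Integrable.of_bound hG.aestronglyMeasurable K (ae_of_all _ fun p => hK _)
      have e1 : ∫ ω, g (opinions x ω (t + 1)) ∂(completeLaw n) =
          ∫ p, g (step p.1 p.2) ∂((completeLaw n).map fun ω => (opinions x ω t, ω t)) := by
        rw [integral_map (hmo.prodMk hmt).aemeasurable hG.aestronglyMeasurable]
        rfl
      rw [e1, hmap, hsel, integral_prod _ hint,
        integral_map hmo.aemeasurable (measurable_of_countable _).aestronglyMeasurable]
      refine integral_congr_ae (ae_of_all _ fun ω => ?_)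
      simp only
      rw [PMF.integral_eq_sum, Fintype.sum_prod_type, transition_apply]
      simp only [selection_apply hn, smul_eq_mul]
    -- Averaging preserves the bound `K`, so the induction hypothesis applies to `transition n g`.
    · intro y
      have hc := transition_const hn K
      have hc' := transition_const hn (-K)
      have hI : Invariant fun _ : Fin n → ℤ => True := fun _ _ _ => trivial
      rw [abs_le]
      constructor
      · have := transition_mono hI (g := fun _ => -K) (h := g)
          (fun y _ => (abs_le.1 (hK y)).1) (x := y) trivial
        rwa [hc'] at this
      · have := transition_mono hI (g := g) (h := fun _ => K)
          (fun y _ => (abs_le.1 (hK y)).2) (x := y) trivial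
        rwa [hc] at this

open Classical in
/-- The indicator function of a property of opinion vectors. -/
noncomputable def ind {n : ℕ} (A : (Fin n → ℤ) → Prop) (x : Fin n → ℤ) : ℝ :=
  if A x then 1 else 0

lemma ind_nonneg {n : ℕ} (A : (Fin n → ℤ) → Prop) (x : Fin n → ℤ) : 0 ≤ ind A x := by
  unfold ind; split_ifs <;> norm_num

lemma ind_le_one {n : ℕ} (A : (Fin n → ℤ) → Prop) (x : Fin n → ℤ) : ind A x ≤ 1 := by
  unfold ind; split_ifs <;> norm_num

lemma measurableSet_opinions {n : ℕ} (x : Fin n → ℤ) (t : ℕ) (A : (Fin n → ℤ) → Prop) :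
    MeasurableSet {ω : ℕ → Fin n × Fin n | A (opinions x ω t)} :=
  measurable_opinions x t (Set.to_countable {y | A y}).measurableSet

lemma completeLaw_real_opinions {n : ℕ} (hn : 2 ≤ n) (x : Fin n → ℤ) (t : ℕ)
    (A : (Fin n → ℤ) → Prop) :
    (completeLaw n).real {ω | A (opinions x ω t)} = (transition n ^ t) (ind A) x := by
  rw [← integral_opinions hn x t (ind A) 1 fun y => by
    rw [abs_of_nonneg (ind_nonneg A y)]; exact ind_le_one A y]
  rw [← integral_indicator_one (measurableSet_opinions x t A)]
  refine integral_congr_ae (ae_of_all _ fun ω => ?_)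
  simp [Set.indicator, ind]

/-! ### Opinions in an interval -/

/-- All opinions lie between `m` and `M`. -/
def InRange {n : ℕ} (m M : ℤ) (x : Fin n → ℤ) : Prop :=
  ∀ v, m ≤ x v ∧ x v ≤ M

lemma invariant_inRange {n : ℕ} (m M : ℤ) : Invariant (InRange (n := n) m M) := by
  intro x hx e v
  have h1 := hx e.1
  have h2 := hx e.2
  unfold step
  by_cases hv : v = e.1
  · subst hv
    rw [Function.update_self]
    unfold nudge
    split_ifs <;> omega
  · rw [Function.update_of_ne hv]
    exact hx v

/-! ### Sums of a function of the opinions -/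

/-- The sum of `f` over all opinions. -/
def total {n : ℕ} (f : ℤ → ℝ) (x : Fin n → ℤ) : ℝ :=
  ∑ v, f (x v)

lemma total_step {n : ℕ} (f : ℤ → ℝ) (x : Fin n → ℤ) (v w : Fin n) :
    total f (step x (v, w)) = total f x + (f (nudge (x v) (x w)) - f (x v)) := by
  have h : total f (step x (v, w)) =
      ∑ u, Function.update (fun u => f (x u)) v (f (nudge (x v) (x w))) u := by
    refine Finset.sum_congr rfl fun u _ => ?_
    by_cases hu : u = v
    · subst hu; simp [step]
    · simp [step, hu]
  rw [h, Finset.sum_update_of_mem (Finset.mem_univ v), total,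
    ← Finset.add_sum_erase _ _ (Finset.mem_univ v), Finset.sdiff_singleton_eq_erase]
  ring

/-- Symmetrising a double sum over the opinions. -/
lemma two_mul_sum_sum {n : ℕ} (h : ℤ → ℤ → ℝ) (x : Fin n → ℤ) :
    2 * ∑ v, ∑ w, h (x v) (x w) = ∑ v, ∑ w, (h (x v) (x w) + h (x w) (x v)) := by
  simp only [Finset.sum_add_distrib]
  rw [Finset.sum_comm (f := fun v w => h (x w) (x v))]
  ring

lemma pairs_pos {n : ℕ} (hn : 2 ≤ n) : 0 < (n : ℝ) * (n - 1) := by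
  have h2 : (2 : ℝ) ≤ n := by exact_mod_cast hn
  exact mul_pos (by linarith) (by linarith)

/-! ### The martingale of the opinion sum and the supermartingale of the gap -/

/-- The sum of the opinions. -/
def opinionSum {n : ℕ} (x : Fin n → ℤ) : ℝ := total (fun z => (z : ℝ)) x

/-- The conservation law behind the martingale: the contributions of `(v, w)` and `(w, v)` to the
drift of the sum cancel. -/
lemma nudge_add_nudge (a b : ℤ) : nudge a b + nudge b a = a + b := by
  unfold nudge; split_ifs <;> omega

lemma sum_nudge_sub {n : ℕ} (x : Fin n → ℤ) :
    ∑ v, ∑ w, ((nudge (x v) (x w) : ℝ) - x v) = 0 := by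
  have h := two_mul_sum_sum (fun a b => (nudge a b : ℝ) - a) x
  have h0 : ∑ v, ∑ w, (((nudge (x v) (x w) : ℝ) - x v) + ((nudge (x w) (x v) : ℝ) - x w)) = 0 := by
    refine Finset.sum_eq_zero fun v _ => Finset.sum_eq_zero fun w _ => ?_
    have : ((nudge (x v) (x w) + nudge (x w) (x v) : ℤ) : ℝ) = ((x v + x w : ℤ) : ℝ) := by
      rw [nudge_add_nudge]
    push_cast at this
    linarith
  rw [h0] at h
  linarith

lemma transition_opinionSum {n : ℕ} (hn : 2 ≤ n) :
    transition n (opinionSum (n := n)) = opinionSum := by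
  funext x
  have h := transition_sub_self hn opinionSum x
  have h0 : ∑ v, ∑ w, (opinionSum (step x (v, w)) - opinionSum x) = 0 := by
    rw [← sum_nudge_sub x]
    refine Finset.sum_congr rfl fun v _ => Finset.sum_congr rfl fun w _ => ?_
    rw [opinionSum, total_step]
    unfold opinionSum
    ring
  rw [h0, zero_div] at h
  linarith

lemma transition_pow_opinionSum {n : ℕ} (hn : 2 ≤ n) (t : ℕ) :
    (transition n ^ t) (opinionSum (n := n)) = opinionSum := by
  induction t with
  | zero => rfl
  | succ t ih => rw [pow_succ, Module.End.mul_apply, transition_opinionSum hn, ih]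

lemma abs_nudge_sub_le (a b : ℤ) : |(nudge a b : ℝ) - a| ≤ 1 := by
  have : |nudge a b - a| ≤ 1 := by
    unfold nudge; split_ifs <;> simp
  exact_mod_cast this

lemma transition_opinionSum_sub_sq_le {n : ℕ} (hn : 2 ≤ n) (s : ℝ) (x : Fin n → ℤ) :
    transition n (fun y => (opinionSum y - s) ^ 2) x ≤ (opinionSum x - s) ^ 2 + 1 := by
  have h := transition_sub_self hn (fun y => (opinionSum y - s) ^ 2) x
  have h1 : ∑ v, ∑ w, ((opinionSum (step x (v, w)) - s) ^ 2 - (opinionSum x - s) ^ 2) ≤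
      (n : ℝ) * (n - 1) := by
    -- The cross term sums to zero by `sum_nudge_sub`. Excluding the diagonal from the bound `1` on
    -- the squared increment leaves exactly `n * (n - 1)` pairs.
    have h2 : ∀ v w : Fin n, (opinionSum (step x (v, w)) - s) ^ 2 - (opinionSum x - s) ^ 2 ≤
        2 * (opinionSum x - s) * ((nudge (x v) (x w) : ℝ) - x v) +
          (1 - if v = w then (1 : ℝ) else 0) := by
      intro v w
      rw [opinionSum, total_step, ← opinionSum]
      by_cases hvw : v = w
      · subst hvw; simp [nudge_self]
      · rw [if_neg hvw]
        have := abs_nudge_sub_le (x v) (x w)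
        have := (sq_le_one_iff_abs_le_one _).2 this
        nlinarith
    calc _ ≤ ∑ v, ∑ w, (2 * (opinionSum x - s) * ((nudge (x v) (x w) : ℝ) - x v) +
          (1 - if v = w then (1 : ℝ) else 0)) :=
          Finset.sum_le_sum fun v _ => Finset.sum_le_sum fun w _ => h2 v w
      _ = (n : ℝ) * (n - 1) := by
          simp only [Finset.sum_add_distrib, ← Finset.mul_sum, sum_nudge_sub]
          simp
          ring
  have h3 : (∑ v, ∑ w, ((opinionSum (step x (v, w)) - s) ^ 2 - (opinionSum x - s) ^ 2)) /
      ((n : ℝ) * (n - 1)) ≤ 1 := (div_le_one (pairs_pos hn)).2 h1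
  linarith

lemma transition_pow_opinionSum_sub_sq_le {n : ℕ} (hn : 2 ≤ n) (s : ℝ) (t : ℕ) :
    ∀ x : Fin n → ℤ, (transition n ^ t) (fun y => (opinionSum y - s) ^ 2) x ≤
      (opinionSum x - s) ^ 2 + t := by
  induction t with
  | zero => intro x; simp
  | succ t ih =>
    intro x
    have hI : Invariant fun _ : Fin n → ℤ => True := fun _ _ _ => trivial
    rw [pow_succ', Module.End.mul_apply]
    calc _ ≤ transition n ((fun y => (opinionSum y - s) ^ 2) + fun _ => (t : ℝ)) x :=
          transition_mono hI (fun y _ => ih y) trivial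
      _ ≤ _ := by
          rw [map_add, transition_const hn]
          have := transition_opinionSum_sub_sq_le hn s x
          simp only [Pi.add_apply]
          push_cast
          linarith

/-- The distance of `z` from the set `{i, i + 1}`. -/
def gap (i z : ℤ) : ℤ := max 0 (max (i - z) (z - i - 1))

/-- `gap i` is convex, and replacing `a`, `b` by the two nudged values keeps their sum without
spreading them apart (adjacent values are merely swapped). This makes `totalGap` a supermartingale.
-/
lemma gap_nudge_add_le (i a b : ℤ) :
    gap i (nudge a b) + gap i (nudge b a) ≤ gap i a + gap i b := by
  unfold gap nudge
  split_ifs <;> omega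

/-- The total distance of the opinions from `{i, i + 1}`. -/
def totalGap {n : ℕ} (i : ℤ) (x : Fin n → ℤ) : ℝ := total (fun z => (gap i z : ℝ)) x

lemma transition_totalGap_le {n : ℕ} (hn : 2 ≤ n) (i : ℤ) (x : Fin n → ℤ) :
    transition n (totalGap i) x ≤ totalGap i x := by
  have h := transition_sub_self hn (totalGap i) x
  have h1 : ∑ v, ∑ w, (totalGap i (step x (v, w)) - totalGap i x) ≤ 0 := by
    have h2 := two_mul_sum_sum (fun a b => (gap i (nudge a b) : ℝ) - gap i a) x
    have h3 : ∑ v, ∑ w, (((gap i (nudge (x v) (x w)) : ℝ) - gap i (x v)) +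
        ((gap i (nudge (x w) (x v)) : ℝ) - gap i (x w))) ≤ 0 := by
      refine Finset.sum_nonpos fun v _ => Finset.sum_nonpos fun w _ => ?_
      have : ((gap i (nudge (x v) (x w)) + gap i (nudge (x w) (x v)) : ℤ) : ℝ) ≤
          ((gap i (x v) + gap i (x w) : ℤ) : ℝ) := by exact_mod_cast gap_nudge_add_le i _ _
      push_cast at this
      linarith
    have h4 : ∑ v, ∑ w, (totalGap i (step x (v, w)) - totalGap i x) =
        ∑ v, ∑ w, ((gap i (nudge (x v) (x w)) : ℝ) - gap i (x v)) := by
      refine Finset.sum_congr rfl fun v _ => Finset.sum_congr rfl fun w _ => ?_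
      rw [totalGap, total_step]
      unfold totalGap
      ring
    rw [h4]
    linarith
  have := div_nonpos_of_nonpos_of_nonneg h1 (pairs_pos hn).le
  linarith

/-! ### Numbers of holders of an opinion -/

/-- The number of vertices with opinion `j`. -/
def count {n : ℕ} (j : ℤ) (x : Fin n → ℤ) : ℕ :=
  (Finset.univ.filter fun v => x v = j).card

/-- The indicator function of `{j}`. -/
def delta (j z : ℤ) : ℝ := if z = j then 1 else 0

lemma count_eq_total {n : ℕ} (j : ℤ) (x : Fin n → ℤ) : (count j x : ℝ) = total (delta j) x := by
  simp [count, total, delta, Finset.sum_boole]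

lemma count_pos {n : ℕ} {j : ℤ} {x : Fin n → ℤ} : 0 < count j x ↔ ∃ v, x v = j := by
  rw [count, Finset.card_pos, Finset.filter_nonempty_iff]
  simp

lemma count_le {n : ℕ} (j : ℤ) (x : Fin n → ℤ) : count j x ≤ n :=
  (Finset.card_filter_le _ _).trans (by simp)

lemma sum_delta_mul_delta {n : ℕ} (a b : ℤ) (x : Fin n → ℤ) :
    ∑ v, ∑ w, delta a (x v) * delta b (x w) = count a x * count b x := by
  rw [count_eq_total, count_eq_total, total, total, Finset.sum_mul_sum]

lemma sum_delta {n : ℕ} (a : ℤ) (x : Fin n → ℤ) : ∑ v, delta a (x v) = count a x :=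
  (count_eq_total a x).symm

/-- With nothing below `m`, the value `m` is entered only from `m + 1` by observing `m`, and left on
observing anything else. -/
lemma delta_nudge_min {m p q : ℤ} (hp : m ≤ p) (hq : m ≤ q) :
    delta m (nudge p q) - delta m p =
      delta (m + 1) p * delta m q - delta m p * (1 - delta m q) := by
  unfold delta nudge
  split_ifs <;> first | omega | norm_num

lemma delta_nudge_max {M p q : ℤ} (hp : p ≤ M) (hq : q ≤ M) :
    delta M (nudge p q) - delta M p =
      delta (M - 1) p * delta M q - delta M p * (1 - delta M q) := by
  unfold delta nudge
  split_ifs <;> first | omega | norm_num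

/-- The product of the numbers of holders of the opinions `m` and `M`. -/
def extremes {n : ℕ} (m M : ℤ) (x : Fin n → ℤ) : ℝ := count m x * count M x

lemma extremes_nonneg {n : ℕ} (m M : ℤ) (x : Fin n → ℤ) : 0 ≤ extremes m M x := by
  unfold extremes; positivity

lemma extremes_le {n : ℕ} (m M : ℤ) (x : Fin n → ℤ) : extremes m M x ≤ (n : ℝ) ^ 2 := by
  have h1 : (count m x : ℝ) ≤ n := by exact_mod_cast count_le m x
  have h2 : (count M x : ℝ) ≤ n := by exact_mod_cast count_le M x
  unfold extremes
  rw [sq]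
  exact mul_le_mul h1 h2 (by positivity) (by positivity)

/-- No single move changes both extreme counts when `m + 2 ≤ M`, so the increment of the product has
no second-order term and the drift is explicit. -/
lemma transition_extremes {n : ℕ} (hn : 2 ≤ n) {m M : ℤ} (hmM : m + 2 ≤ M) {x : Fin n → ℤ}
    (hx : InRange m M x) :
    transition n (extremes m M) x = extremes m M x -
      extremes m M x * ((n - count m x - count (m + 1) x) + (n - count M x - count (M - 1) x)) /
        ((n : ℝ) * (n - 1)) := by
  have h := transition_sub_self hn (extremes m M) x
  have hs : ∑ v, ∑ w, (extremes m M (step x (v, w)) - extremes m M x) =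
      - (extremes m M x *
        ((n - count m x - count (m + 1) x) + (n - count M x - count (M - 1) x))) := by
    have h1 : ∀ v w, extremes m M (step x (v, w)) - extremes m M x =
        count M x * (delta (m + 1) (x v) * delta m (x w) - delta m (x v) +
          delta m (x v) * delta m (x w)) +
        count m x * (delta (M - 1) (x v) * delta M (x w) - delta M (x v) +
          delta M (x v) * delta M (x w)) := by
      intro v w
      have e1 := delta_nudge_min (hx v).1 (hx w).1
      have e2 := delta_nudge_max (hx v).2 (hx w).2
      have e3 : (delta m (nudge (x v) (x w)) - delta m (x v)) *
          (delta M (nudge (x v) (x w)) - delta M (x v)) = 0 := by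
        unfold delta nudge
        split_ifs <;> first | omega | norm_num
      unfold extremes
      simp only [count_eq_total]
      rw [total_step, total_step]
      rw [e1, e2] at e3
      rw [e1, e2]
      linear_combination e3
    rw [Finset.sum_congr rfl fun v _ => Finset.sum_congr rfl fun w _ => h1 v w]
    simp only [Finset.sum_add_distrib, ← Finset.mul_sum, Finset.sum_sub_distrib,
      ← Finset.sum_mul, sum_delta, Finset.sum_const, Finset.card_univ, Fintype.card_fin,
      nsmul_eq_mul]
    unfold extremes
    ring
  rw [hs, neg_div] at h
  linarith

lemma count_add_add_eq {n : ℕ} {m : ℤ} {x : Fin n → ℤ} (hx : InRange m (m + 2) x) :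
    (count m x : ℝ) + count (m + 1) x + count (m + 2) x = n := by
  simp only [count_eq_total, total]
  rw [← Finset.sum_add_distrib, ← Finset.sum_add_distrib]
  rw [Finset.sum_congr rfl (g := fun _ => (1 : ℝ))]
  · simp
  · intro v _
    have := hx v
    unfold delta
    split_ifs <;> first | omega | norm_num

lemma count_add_eq {n : ℕ} {m : ℤ} {x : Fin n → ℤ} (hx : InRange m (m + 1) x) :
    (count m x : ℝ) + count (m + 1) x = n := by
  simp only [count_eq_total, total]
  rw [← Finset.sum_add_distrib]
  rw [Finset.sum_congr rfl (g := fun _ => (1 : ℝ))]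
  · simp
  · intro v _
    have := hx v
    unfold delta
    split_ifs <;> first | omega | norm_num

lemma count_add_four_le {n : ℕ} {m M : ℤ} (hmM : m + 3 ≤ M) (x : Fin n → ℤ) :
    (count m x : ℝ) + count (m + 1) x + count (M - 1) x + count M x ≤ n := by
  simp only [count_eq_total, total]
  rw [← Finset.sum_add_distrib, ← Finset.sum_add_distrib, ← Finset.sum_add_distrib]
  have : (n : ℝ) = ∑ _v : Fin n, (1 : ℝ) := by simp
  rw [this]
  refine Finset.sum_le_sum fun v _ => ?_
  unfold delta
  split_ifs <;> first | omega | norm_num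

/-- With at least four possible values, the product of the numbers of holders of the extreme values
decays geometrically. -/
lemma transition_extremes_le {n : ℕ} (hn : 2 ≤ n) {m M : ℤ} (hmM : m + 3 ≤ M) {x : Fin n → ℤ}
    (hx : InRange m M x) :
    transition n (extremes m M) x ≤ (1 - 1 / n) * extremes m M x := by
  rw [transition_extremes hn (by omega) hx]
  have h4 := count_add_four_le hmM x
  have h0 := extremes_nonneg m M x
  have h2 : (2 : ℝ) ≤ n := by exact_mod_cast hn
  have hp := pairs_pos hn
  -- The four values `m`, `m + 1`, `M - 1`, `M` are distinct and have at most `n` holders together,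
  -- so the bracket is at least `n`.
  have : extremes m M x * (1 / n) ≤ extremes m M x * ((n - count m x - count (m + 1) x) +
      (n - count M x - count (M - 1) x)) / ((n : ℝ) * (n - 1)) := by
    rw [mul_div_assoc]
    refine mul_le_mul_of_nonneg_left ?_ h0
    rw [le_div_iff₀ hp]
    have : 1 / (n : ℝ) * (n * (n - 1)) = n - 1 := by field_simp
    rw [this]
    linarith
  linarith

/-- The exact drift with three possible values. -/
lemma transition_extremes_three {n : ℕ} (hn : 2 ≤ n) {m : ℤ} {x : Fin n → ℤ}
    (hx : InRange m (m + 2) x) :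
    transition n (extremes m (m + 2)) x = extremes m (m + 2) x -
      extremes m (m + 2) x * (count m x + count (m + 2) x) / ((n : ℝ) * (n - 1)) := by
  rw [transition_extremes hn le_rfl hx, show m + 2 - 1 = m + 1 by ring]
  have h := count_add_add_eq hx
  have : (n : ℝ) - count m x - count (m + 1) x + (n - count (m + 2) x - count (m + 1) x) =
      count m x + count (m + 2) x := by linarith
  rw [this]

/-! ### Reduction to three consecutive values -/

lemma InRange.atMostThreeConsecutive {n : ℕ} {m : ℤ} {x : Fin n → ℤ} (hx : InRange m (m + 2) x) :
    AtMostThreeConsecutive x := by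
  refine ⟨m + 1, fun v => ?_⟩
  have := hx v
  omega

lemma AtMostThreeConsecutive.exists_inRange {n : ℕ} {x : Fin n → ℤ}
    (hx : AtMostThreeConsecutive x) : ∃ m, InRange m (m + 2) x := by
  obtain ⟨j, hj⟩ := hx
  refine ⟨j - 1, fun v => ?_⟩
  have := hj v
  omega

lemma InRange.of_count_min_eq_zero {n : ℕ} {m M : ℤ} {x : Fin n → ℤ} (hx : InRange m M x)
    (h : count m x = 0) : InRange (m + 1) M x := by
  intro v
  have h1 : x v ≠ m := fun hv => (count_pos.2 ⟨v, hv⟩).ne' h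
  have := hx v
  omega

lemma InRange.of_count_max_eq_zero {n : ℕ} {m M : ℤ} {x : Fin n → ℤ} (hx : InRange m M x)
    (h : count M x = 0) : InRange m (M - 1) x := by
  intro v
  have h1 : x v ≠ M := fun hv => (count_pos.2 ⟨v, hv⟩).ne' h
  have := hx v
  omega

lemma one_sub_div_nonneg {n : ℕ} (hn : 2 ≤ n) {δ : ℝ} (hδ : δ ≤ 1) : 0 ≤ 1 - δ / (n : ℝ) := by
  have h2 : (2 : ℝ) ≤ n := by exact_mod_cast hn
  rw [sub_nonneg, div_le_one (by linarith)]
  linarith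

/-- The probability that more than three consecutive values are needed after `r` phases of
length `T`. -/
lemma transition_pow_not_three_le {n : ℕ} (hn : 2 ≤ n) (T : ℕ) (r : ℕ) :
    ∀ (m : ℤ) (x : Fin n → ℤ), InRange m (m + 2 + r) x →
      (transition n ^ (r * T)) (ind fun y => ¬ AtMostThreeConsecutive y) x ≤
        r * ((1 - 1 / (n : ℝ)) ^ T * (n : ℝ) ^ 2) := by
  induction r with
  | zero =>
    intro m x hx
    have : AtMostThreeConsecutive x := InRange.atMostThreeConsecutive (m := m) (by simpa using hx)
    simp [ind, this]
  | succ r ih =>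
    intro m x hx
    set ε : ℝ := (1 - 1 / (n : ℝ)) ^ T * (n : ℝ) ^ 2
    have hI := invariant_inRange (n := n) m (m + 2 + (r + 1 : ℕ))
    have hε : 0 ≤ ε := mul_nonneg (pow_nonneg (one_sub_div_nonneg hn le_rfl) T) (by positivity)
    -- State after the first phase: if an extreme value has died out, the induction hypothesis
    -- covers the remaining `r` phases. Otherwise the product of counts is an integer at least `1`,
    -- and it dominates the probability as in Markov's inequality.
    have h1 : ∀ y : Fin n → ℤ, InRange m (m + 2 + (r + 1 : ℕ)) y →
        (transition n ^ (r * T)) (ind fun y => ¬ AtMostThreeConsecutive y) y ≤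
          ((fun _ => r * ε) + extremes m (m + 2 + (r + 1 : ℕ)) : (Fin n → ℤ) → ℝ) y := by
      intro y hy
      simp only [Pi.add_apply]
      by_cases h0 : count m y = 0
      · have := ih (m + 1) y (by
          have := hy.of_count_min_eq_zero h0
          convert this using 1
          push_cast; ring)
        have := extremes_nonneg m (m + 2 + (r + 1 : ℕ)) y
        linarith
      by_cases h0' : count (m + 2 + (r + 1 : ℕ)) y = 0
      · have := ih m y (by
          have := hy.of_count_max_eq_zero h0'
          convert this using 1
          push_cast; ring)
        have := extremes_nonneg m (m + 2 + (r + 1 : ℕ)) y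
        linarith
      · have h2 : (1 : ℝ) ≤ extremes m (m + 2 + (r + 1 : ℕ)) y := by
          unfold extremes
          exact_mod_cast Nat.mul_pos (Nat.pos_of_ne_zero h0) (Nat.pos_of_ne_zero h0')
        have h3 := transition_pow_mono (n := n) (I := fun _ => True) (fun _ _ _ => trivial)
          (g := ind fun y => ¬ AtMostThreeConsecutive y) (h := fun _ => 1)
          (fun y _ => ind_le_one _ y) (r * T) y trivial
        rw [transition_pow_const hn] at h3
        have : 0 ≤ (r : ℝ) * ε := by positivity
        linarith
    have h2 := transition_pow_mono hI h1 T x hx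
    rw [map_add, transition_pow_const hn, ← Module.End.mul_apply, ← pow_add] at h2
    have h3 := transition_pow_le_of_contracting hI (one_sub_div_nonneg hn le_rfl)
      (fun y hy => transition_extremes_le hn (by push_cast; omega) hy) T x hx
    have h4 := mul_le_mul_of_nonneg_left (extremes_le m (m + 2 + (r + 1 : ℕ)) x)
      (pow_nonneg (one_sub_div_nonneg hn le_rfl) T)
    rw [show (r + 1) * T = T + r * T by ring]
    simp only [Pi.add_apply] at h2
    push_cast at *
    linarith

/-! ### Three consecutive values -/

/-- The product $AD$ contracts at rate $(A+D)/(n(n-1))$, which exceeds $\delta/n$ when $A+D\ge\delta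
n$. Otherwise $AD\le(\delta n)^2/4$ already. Hence the excess of $AD$ over $(\delta n)^2/4$
contracts by $1-\delta/n$ in expectation. -/
lemma transition_pow_extremes_three_le {n : ℕ} (hn : 2 ≤ n) {δ : ℝ} (hδ0 : 0 ≤ δ) (hδ1 : δ ≤ 1)
    {m : ℤ} {x : Fin n → ℤ} (hx : InRange m (m + 2) x) (t : ℕ) :
    (transition n ^ t) (extremes m (m + 2)) x ≤
      (1 - δ / n) ^ t * (n : ℝ) ^ 2 + (δ * n) ^ 2 / 4 := by
  have h2 : (2 : ℝ) ≤ n := by exact_mod_cast hn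
  have hdec : ∀ y : Fin n → ℤ, InRange m (m + 2) y →
      transition n (extremes m (m + 2) - (fun _ => (δ * n) ^ 2 / 4) : (Fin n → ℤ) → ℝ) y ≤
        (1 - δ / n) *
          (extremes m (m + 2) - (fun _ => (δ * n) ^ 2 / 4) : (Fin n → ℤ) → ℝ) y := by
    intro y hy
    rw [map_sub, transition_const hn]
    simp only [Pi.sub_apply]
    rw [transition_extremes_three hn hy]
    have hA : (0 : ℝ) ≤ count m y := by positivity
    have hD : (0 : ℝ) ≤ count (m + 2) y := by positivity
    unfold extremes
    generalize (count m y : ℝ) = A at *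
    generalize (count (m + 2) y : ℝ) = D at *
    have hE : 0 ≤ A * D * (A + D) := by positivity
    have h3 : A * D * (A + D) / (n : ℝ) ^ 2 ≤ A * D * (A + D) / ((n : ℝ) * (n - 1)) := by
      apply div_le_div_of_nonneg_left hE (pairs_pos hn)
      nlinarith
    -- With $d=\delta n$: the claim is immediate if $A+D\ge d$. If not, $AD\le d^2/4$ is multiplied
    -- by $d-(A+D)\le d$.
    have h4 : δ * n * (A * D) - (δ * n) ^ 3 / 4 ≤ A * D * (A + D) := by
      have hd : 0 ≤ δ * n := by positivity
      generalize δ * (n : ℝ) = d at *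
      rcases le_total d (A + D) with h | h
      · have : d * (A * D) ≤ (A + D) * (A * D) := mul_le_mul_of_nonneg_right h (by positivity)
        have : 0 ≤ d ^ 3 := by positivity
        linarith
      · have e1 : A * D ≤ d ^ 2 / 4 := by nlinarith [sq_nonneg (A - D)]
        have e2 : A * D * (d - (A + D)) ≤ d ^ 2 / 4 * d :=
          mul_le_mul e1 (by linarith) (by linarith) (by positivity)
        nlinarith
    have h5 : (δ * n * (A * D) - (δ * n) ^ 3 / 4) / (n : ℝ) ^ 2 ≤ A * D * (A + D) / (n : ℝ) ^ 2 :=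
      div_le_div_of_nonneg_right h4 (by positivity)
    have h6 : (δ * n * (A * D) - (δ * n) ^ 3 / 4) / (n : ℝ) ^ 2 =
        δ / n * (A * D) - δ / n * ((δ * n) ^ 2 / 4) := by
      field_simp
    linarith
  have ha := one_sub_div_nonneg hn hδ1
  have h := transition_pow_le_of_contracting (invariant_inRange m (m + 2)) ha hdec t x hx
  rw [map_sub, transition_pow_const hn] at h
  simp only [Pi.sub_apply] at h
  have h3 := pow_nonneg ha t
  have h4 : (1 - δ / n) ^ t * (extremes m (m + 2) x - (δ * n) ^ 2 / 4) ≤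
      (1 - δ / n) ^ t * (n : ℝ) ^ 2 := by
    refine mul_le_mul_of_nonneg_left ?_ h3
    have := extremes_le m (m + 2) x
    have : 0 ≤ (δ * (n : ℝ)) ^ 2 / 4 := by positivity
    linarith
  linarith

/-- If the three values all lie on one side, at most `i` or at least `i + 1`, then `gap i` is affine
on them and the total gap is at most the deviation of the sum from `n * c`. If the middle value is
`i` or `i + 1`, the total gap is one outer count, and the sum bounds it by the other outer count
plus the deviation. -/
lemma totalGap_le_min_add {n : ℕ} {m i : ℤ} {c : ℝ} (hic : (i : ℝ) ≤ c) (hci : c ≤ i + 1)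
    {x : Fin n → ℤ} (hx : InRange m (m + 2) x) :
    totalGap i x ≤ min (count m x : ℝ) (count (m + 2) x) + |opinionSum x - n * c| := by
  have hA : (0 : ℝ) ≤ count m x := by positivity
  have hD : (0 : ℝ) ≤ count (m + 2) x := by positivity
  have hmin : 0 ≤ min (count m x : ℝ) (count (m + 2) x) := le_min hA hD
  have hn : (0 : ℝ) ≤ n := by positivity
  have habs := neg_abs_le (opinionSum x - n * c)
  have habs' := le_abs_self (opinionSum x - n * c)
  have k1 : (n : ℝ) * i ≤ n * c := mul_le_mul_of_nonneg_left hic hn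
  have k2 : (n : ℝ) * c ≤ n * (i + 1) := mul_le_mul_of_nonneg_left hci hn
  have hsum : ∀ (f g : ℤ → ℝ), (∀ z, m ≤ z → z ≤ m + 2 → f z = g z) →
      total f x = total g x := fun f g h =>
    Finset.sum_congr rfl fun v _ => h _ (hx v).1 (hx v).2
  rcases lt_trichotomy (m + 1) i with h | h | h
  · have e : totalGap i x = n * i - opinionSum x := by
      rw [totalGap, hsum _ (fun z => (i : ℝ) - z)]
      · simp [total, opinionSum]
      · intro z h1 h2
        have : gap i z = i - z := by unfold gap; omega
        rw [this]; push_cast; ring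
    linarith
  · have e : totalGap i x = count m x := by
      rw [totalGap, count_eq_total, hsum _ (delta m)]
      intro z h1 h2
      unfold gap delta
      have : max 0 (max (i - z) (z - i - 1)) = if z = m then 1 else 0 := by split_ifs <;> omega
      rw [this]; push_cast; rfl
    have e' : opinionSum x = n * i + count (m + 2) x - count m x := by
      rw [opinionSum, hsum _ (fun z => i + delta (m + 2) z - delta m z)]
      · rw [count_eq_total, count_eq_total]
        simp [total, Finset.sum_add_distrib]
      · intro z h1 h2
        unfold delta
        have hz : z = m ∨ z = m + 1 ∨ z = m + 2 := by omega
        subst h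
        rcases hz with rfl | rfl | rfl <;> norm_num <;> ring
    rw [e]
    rcases min_choice (count m x : ℝ) (count (m + 2) x) with h' | h' <;> rw [h'] <;> linarith [
      abs_nonneg (opinionSum x - n * c)]
  · rcases eq_or_lt_of_le (Int.add_one_le_of_lt h) with h | h
    · have e : totalGap i x = count (m + 2) x := by
        rw [totalGap, count_eq_total, hsum _ (delta (m + 2))]
        intro z h1 h2
        unfold gap delta
        have : max 0 (max (i - z) (z - i - 1)) = if z = m + 2 then 1 else 0 := by
          split_ifs <;> omega
        rw [this]; push_cast; rfl
      have e' : opinionSum x = n * (i + 1) + count (m + 2) x - count m x := by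
        rw [opinionSum, hsum _ (fun z => (i + 1 : ℝ) + delta (m + 2) z - delta m z)]
        · rw [count_eq_total, count_eq_total]
          simp [total, Finset.sum_add_distrib]
          ring
        · intro z h1 h2
          unfold delta
          have hz : z = m ∨ z = m + 1 ∨ z = m + 2 := by omega
          obtain rfl : i = m := by omega
          rcases hz with rfl | rfl | rfl <;> norm_num <;> ring
      rw [e]
      rcases min_choice (count m x : ℝ) (count (m + 2) x) with h' | h' <;> rw [h'] <;> linarith [
        abs_nonneg (opinionSum x - n * c)]
    · have e : totalGap i x = opinionSum x - n * (i + 1) := by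
        rw [totalGap, hsum _ (fun z => (z : ℝ) - (i + 1))]
        · simp [total, opinionSum]
          ring
        · intro z h1 h2
          have : gap i z = z - i - 1 := by unfold gap; omega
          rw [this]; push_cast; ring
      linarith

/-- Uses $\min(A,D)^2\le AD$ and $u\le l/2+u^2/(2l)$ to pass to the two quantities whose
expectations are controlled. -/
lemma totalGap_le {n : ℕ} {m i : ℤ} {c : ℝ} (hic : (i : ℝ) ≤ c) (hci : c ≤ i + 1)
    {x : Fin n → ℤ} (hx : InRange m (m + 2) x) {l : ℝ} (hl : 0 < l) :
    totalGap i x ≤ l + extremes m (m + 2) x / (2 * l) +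
      (opinionSum x - n * c) ^ 2 / (2 * l) := by
  have h := totalGap_le_min_add hic hci hx
  have hA : (0 : ℝ) ≤ count m x := by positivity
  have hD : (0 : ℝ) ≤ count (m + 2) x := by positivity
  have key : ∀ u w : ℝ, u ^ 2 ≤ w → u ≤ l / 2 + w / (2 * l) := by
    intro u w huw
    have : l / 2 + w / (2 * l) = (l ^ 2 + w) / (2 * l) := by field_simp
    rw [this, le_div_iff₀ (by positivity)]
    nlinarith [sq_nonneg (u - l)]
  have h1 := key (min (count m x : ℝ) (count (m + 2) x)) (extremes m (m + 2) x) (by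
    unfold extremes
    rw [sq]
    exact mul_le_mul (min_le_left _ _) (min_le_right _ _) (le_min hA hD) hA)
  have h2 := key |opinionSum x - n * c| ((opinionSum x - n * c) ^ 2) (sq_abs _).le
  linarith

lemma totalGap_le_of_inRange {n k : ℕ} {i : ℤ} {c : ℝ} (hic : (i : ℝ) ≤ c) (hci : c ≤ i + 1)
    (h1c : 1 ≤ c) (hck : c ≤ k) {x : Fin n → ℤ} (hx : InRange 1 k x) :
    totalGap i x ≤ n * k := by
  have h0 : (0 : ℤ) ≤ i := by
    have : (0 : ℝ) ≤ i := by linarith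
    exact_mod_cast this
  have h1 : i ≤ k := by
    have : (i : ℝ) ≤ k := by linarith
    exact_mod_cast this
  have h : ∀ v ∈ (Finset.univ : Finset (Fin n)), (gap i (x v) : ℝ) ≤ k := by
    intro v _
    have : gap i (x v) ≤ k := by
      have := hx v
      unfold gap
      omega
    exact_mod_cast this
  simpa [totalGap, total] using Finset.sum_le_card_nsmul _ _ _ h

lemma transition_pow_totalGap_antitone {n : ℕ} (hn : 2 ≤ n) (i : ℤ) (s t : ℕ) (x : Fin n → ℤ) :
    (transition n ^ (s + t)) (totalGap i) x ≤ (transition n ^ t) (totalGap i) x := by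
  induction s with
  | zero => simp
  | succ s ih =>
    refine le_trans ?_ ih
    rw [show s + 1 + t = s + t + 1 by ring, pow_succ, Module.End.mul_apply]
    exact transition_pow_mono (I := fun _ => True) (fun _ _ _ => trivial)
      (fun y _ => transition_totalGap_le hn i y) _ x trivial

/-- One phase from the state `y`. If `y` needs more than three consecutive values, only the crude
bound `n * k` is used, paid for by the indicator term. -/
lemma transition_pow_totalGap_le {n k : ℕ} (hn : 2 ≤ n) {i : ℤ} {c : ℝ} (hic : (i : ℝ) ≤ c)
    (hci : c ≤ i + 1) (h1c : 1 ≤ c) (hck : c ≤ k) {l δ : ℝ} (hl : 0 < l) (hδ0 : 0 ≤ δ)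
    (hδ1 : δ ≤ 1) (T : ℕ) {y : Fin n → ℤ} (hy : InRange 1 k y) :
    (transition n ^ T) (totalGap i) y ≤
      l + ((1 - δ / n) ^ T * (n : ℝ) ^ 2 + (δ * n) ^ 2 / 4 + T) / (2 * l) +
        (opinionSum y - n * c) ^ 2 / (2 * l) +
        n * k * ind (fun y => ¬ AtMostThreeConsecutive y) y := by
  have ha := pow_nonneg (one_sub_div_nonneg hn hδ1) T
  by_cases h3 : AtMostThreeConsecutive y
  · obtain ⟨m, hm⟩ := h3.exists_inRange
    have h1 := transition_pow_mono (invariant_inRange (n := n) m (m + 2))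
      (g := totalGap i) (h := (fun _ => l) + (1 / (2 * l)) • extremes m (m + 2) +
        (1 / (2 * l)) • fun y => (opinionSum y - n * c) ^ 2)
      (fun z hz => by
        have := totalGap_le hic hci hz hl
        simp only [Pi.add_apply, Pi.smul_apply, smul_eq_mul]
        convert this using 1
        ring) T y hm
    rw [map_add, map_add, map_smul, map_smul, transition_pow_const hn] at h1
    simp only [Pi.add_apply, Pi.smul_apply, smul_eq_mul] at h1
    have h2 := transition_pow_extremes_three_le hn hδ0 hδ1 hm T
    have h4 := transition_pow_opinionSum_sub_sq_le hn (n * c) T y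
    have hl2 : 0 ≤ 1 / (2 * l) := by positivity
    have h5 := mul_le_mul_of_nonneg_left h2 hl2
    have h6 := mul_le_mul_of_nonneg_left h4 hl2
    have h7 : 0 ≤ (n : ℝ) * k * ind (fun y => ¬ AtMostThreeConsecutive y) y :=
      mul_nonneg (by positivity) (ind_nonneg _ _)
    have e : ((1 - δ / n) ^ T * (n : ℝ) ^ 2 + (δ * n) ^ 2 / 4 + T) / (2 * l) +
        (opinionSum y - n * c) ^ 2 / (2 * l) =
        1 / (2 * l) * ((1 - δ / n) ^ T * (n : ℝ) ^ 2 + (δ * n) ^ 2 / 4) +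
        1 / (2 * l) * ((opinionSum y - n * c) ^ 2 + T) := by ring
    linarith
  · have h1 := transition_pow_totalGap_antitone hn i T 0 y
    have h2 := totalGap_le_of_inRange hic hci h1c hck hy
    have h4 : ind (fun y : Fin n → ℤ => ¬ AtMostThreeConsecutive y) y = 1 := by simp [ind, h3]
    simp only [add_zero, pow_zero, Module.End.one_apply] at h1
    have h5 : 0 ≤ ((1 - δ / n) ^ T * (n : ℝ) ^ 2 + (δ * n) ^ 2 / 4 + T) / (2 * l) := by positivity
    have h6 : 0 ≤ (opinionSum y - n * c) ^ 2 / (2 * l) := by positivity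
    rw [h4]
    linarith

lemma opinionSum_eq {n : ℕ} (hn : 2 ≤ n) (x : Fin n → ℤ) : opinionSum x = n * average x := by
  have h2 : (2 : ℝ) ≤ n := by exact_mod_cast hn
  unfold opinionSum total average
  field_simp

lemma average_mem_Icc {n k : ℕ} (hn : 2 ≤ n) {x : Fin n → ℤ} (hx : InRange 1 k x) :
    1 ≤ average x ∧ average x ≤ k := by
  have h2 : (2 : ℝ) ≤ n := by exact_mod_cast hn
  have hpos : (0 : ℝ) < n := by linarith
  have h1 := Finset.sum_le_sum (s := (Finset.univ : Finset (Fin n))) (f := fun _ => (1 : ℝ))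
    (g := fun v => (x v : ℝ)) fun v _ => by exact_mod_cast (hx v).1
  have h3 := Finset.sum_le_sum (s := (Finset.univ : Finset (Fin n))) (f := fun v => (x v : ℝ))
    (g := fun _ => (k : ℝ)) fun v _ => by exact_mod_cast (hx v).2
  simp only [Finset.sum_const, Finset.card_univ, Fintype.card_fin, nsmul_eq_mul] at h1 h3
  unfold average
  rw [le_div_iff₀ hpos, div_le_iff₀ hpos]
  constructor <;> linarith

/-- The bound for the expected total distance from `{i, i + 1}` at time `(k + 1) T`. -/
lemma transition_pow_totalGap_le_of_average {n k : ℕ} (hn : 2 ≤ n) {i : ℤ} {x : Fin n → ℤ}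
    (hic : (i : ℝ) ≤ average x) (hci : average x ≤ i + 1) {l δ : ℝ} (hl : 0 < l) (hδ0 : 0 ≤ δ)
    (hδ1 : δ ≤ 1) (T : ℕ) (hx : InRange 1 k x) :
    (transition n ^ (k * T + T)) (totalGap i) x ≤
      l + ((1 - δ / n) ^ T * (n : ℝ) ^ 2 + (δ * n) ^ 2 / 4 + T) / (2 * l) +
        (k * T : ℕ) / (2 * l) +
        n * k * (k * ((1 - 1 / (n : ℝ)) ^ T * (n : ℝ) ^ 2)) := by
  obtain ⟨h1c, hck⟩ := average_mem_Icc hn hx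
  rw [pow_add, Module.End.mul_apply]
  have h1 := transition_pow_mono (invariant_inRange (n := n) 1 k)
    (g := (transition n ^ T) (totalGap i))
    (h := (fun _ => l + ((1 - δ / n) ^ T * (n : ℝ) ^ 2 + (δ * n) ^ 2 / 4 + T) / (2 * l)) +
      (1 / (2 * l)) • (fun y => (opinionSum y - n * average x) ^ 2) +
      (n * k : ℝ) • ind fun y => ¬ AtMostThreeConsecutive y)
    (fun y hy => by
      have := transition_pow_totalGap_le hn hic hci h1c hck hl hδ0 hδ1 T hy
      simp only [Pi.add_apply, Pi.smul_apply, smul_eq_mul]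
      convert this using 3
      ring) (k * T) x hx
  rw [map_add, map_add, map_smul, map_smul, transition_pow_const hn] at h1
  simp only [Pi.add_apply, Pi.smul_apply, smul_eq_mul] at h1
  have h2 := transition_pow_opinionSum_sub_sq_le hn (n * average x) (k * T) x
  rw [opinionSum_eq hn x, sub_self, zero_pow two_ne_zero, zero_add] at h2
  have h3 := transition_pow_not_three_le hn T k 1 x fun v => by
    have := hx v
    omega
  have h4 := mul_le_mul_of_nonneg_left h2 (show 0 ≤ 1 / (2 * l) by positivity)
  have h5 := mul_le_mul_of_nonneg_left h3 (show (0 : ℝ) ≤ n * k by positivity)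
  have e : 1 / (2 * l) * ((k * T : ℕ) : ℝ) = (k * T : ℕ) / (2 * l) := by ring
  linarith

/-! ### The winning opinion -/

/-- All vertices hold the same opinion. -/
def Consensus {n : ℕ} (x : Fin n → ℤ) : Prop := ∀ v w, x v = x w

lemma opinions_eq_of_le {V : Type*} [DecidableEq V] (x : V → ℤ) (ω : ℕ → V × V) {j : ℤ}
    {s t : ℕ} (hst : s ≤ t) (h : ∀ v, opinions x ω s v = j) : ∀ v, opinions x ω t v = j := by
  induction t, hst using Nat.le_induction with
  | base => exact h
  | succ t _ ih =>
    intro v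
    rw [opinions, step, ih, ih, nudge_self]
    by_cases hv : v = (ω t).1
    · rw [hv, Function.update_self]
    · rw [Function.update_of_ne hv, ih]

/-- Consensus is absorbing, so the events increase with `t` and continuity from below applies. -/
lemma tendsto_winProb {n : ℕ} (hn : 2 ≤ n) (x : Fin n → ℤ) (j : ℤ) :
    Tendsto (fun t => (transition n ^ t) (ind fun y => ∀ v, y v = j) x) atTop
      (𝓝 (winProb x j)) := by
  have := isProbabilityMeasure_completeLaw hn
  have h : {ω : ℕ → Fin n × Fin n | ∃ t, ∀ v, opinions x ω t v = j} =
      ⋃ t, {ω | ∀ v, opinions x ω t v = j} := by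
    ext ω; simp
  have hmono : Monotone fun t => {ω : ℕ → Fin n × Fin n | ∀ v, opinions x ω t v = j} :=
    fun s t hst ω hω => opinions_eq_of_le x ω hst hω
  have ht := tendsto_measure_iUnion_atTop (μ := completeLaw n) hmono
  rw [← h] at ht
  have ht' := (ENNReal.tendsto_toReal (measure_ne_top _ _)).comp ht
  refine ht'.congr fun t => ?_
  exact completeLaw_real_opinions hn x t fun y => ∀ v, y v = j

/-- If consensus is reached almost surely, then the distribution of the winning opinion is
determined by the initial average up to the expected total distance from `{i, i + 1}`. -/
lemma abs_winProb_sub_le {n k : ℕ} (hn : 2 ≤ n) {x : Fin n → ℤ} (hx : InRange 1 k x)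
    (hcons : Tendsto (fun t => (transition n ^ t) (ind fun y => ¬ Consensus y) x) atTop (𝓝 0))
    {i j : ℤ} {a b : ℝ} (hj : ∀ w : ℤ, |delta j w - (a * w + b)| ≤ 2 * gap i w) (T : ℕ) :
    |winProb x j - (a * average x + b)| ≤
      2 / n * (transition n ^ T) (totalGap i) x := by
  have h2 : (2 : ℝ) ≤ n := by exact_mod_cast hn
  have hpos : (0 : ℝ) < n := by linarith
  set K : ℝ := |a| * k + |b|
  set g : (Fin n → ℤ) → ℝ := (ind fun y => ∀ v, y v = j) - ((a / n) • opinionSum + fun _ => b)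
  set h : (Fin n → ℤ) → ℝ := (2 / n : ℝ) • totalGap i + K • ind fun y => ¬ Consensus y
  -- At consensus on `w` this is the hypothesis `hj`. Elsewhere the affine part is at most `K`,
  -- which is charged to the indicator of non-consensus.
  have hgh : ∀ y : Fin n → ℤ, InRange 1 k y → |g y| ≤ h y := by
    intro y hy
    simp only [g, h, Pi.sub_apply, Pi.add_apply, Pi.smul_apply, smul_eq_mul]
    by_cases hc : Consensus y
    · have hw : ∀ v, y v = y ⟨0, by omega⟩ := fun v => hc _ _
      generalize y ⟨0, by omega⟩ = w at hw
      obtain rfl : y = fun _ => w := funext hw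
      have e1 : ind (fun y : Fin n → ℤ => ¬ Consensus y) (fun _ => w) = 0 := by simp [ind, hc]
      have e2 : ind (fun y : Fin n → ℤ => ∀ v, y v = j) (fun _ => w) = delta j w := by
        unfold ind delta
        have : (∀ _v : Fin n, w = j) ↔ w = j := ⟨fun h => h ⟨0, by omega⟩, fun h _ => h⟩
        simp only [this]
      have e3 : a / n * opinionSum (fun _ : Fin n => w) + b = a * w + b := by
        simp only [opinionSum, total, Finset.sum_const, Finset.card_univ, Fintype.card_fin,
          nsmul_eq_mul]
        field_simp
      have e4 : 2 / n * totalGap i (fun _ : Fin n => w) = 2 * gap i w := by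
        simp only [totalGap, total, Finset.sum_const, Finset.card_univ, Fintype.card_fin,
          nsmul_eq_mul]
        field_simp
      rw [e1, e2, e3, e4, mul_zero, add_zero]
      exact hj w
    · have e1 : ind (fun y : Fin n → ℤ => ¬ Consensus y) y = 1 := by simp [ind, hc]
      have e2 : ind (fun y : Fin n → ℤ => ∀ v, y v = j) y = 0 := by
        unfold ind
        rw [if_neg]
        exact fun hy => hc fun v w => by rw [hy, hy]
      have e3 : 0 ≤ 2 / n * totalGap i y := by
        refine mul_nonneg (by positivity) ?_
        unfold totalGap total
        refine Finset.sum_nonneg fun v _ => ?_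
        exact Int.cast_nonneg (le_max_left _ _)
      obtain ⟨h1, h3⟩ := average_mem_Icc hn hy
      rw [e1, e2, opinionSum_eq hn, zero_sub, abs_neg, mul_one]
      have e4 : a / n * (n * average y) = a * average y := by field_simp
      rw [e4]
      have e5 : |a * average y + b| ≤ K := by
        refine (abs_add_le _ _).trans ?_
        rw [abs_mul, abs_of_nonneg (show 0 ≤ average y by linarith)]
        have := mul_le_mul_of_nonneg_left h3 (abs_nonneg a)
        linarith
      linarith
  have hI := invariant_inRange (n := n) 1 k
  have hbound : ∀ t, |(transition n ^ (t + T)) g x| ≤ (transition n ^ (t + T)) h x := by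
    intro t
    rw [abs_le]
    constructor
    · have := transition_pow_mono hI (g := -h) (h := g)
        (fun y hy => (abs_le.1 (hgh y hy)).1) (t + T) x hx
      rwa [map_neg] at this
    · exact transition_pow_mono hI (fun y hy => (abs_le.1 (hgh y hy)).2) (t + T) x hx
  have hbound' : ∀ t, |(transition n ^ (t + T)) (ind fun y => ∀ v, y v = j) x -
      (a * average x + b)| ≤ 2 / n * (transition n ^ T) (totalGap i) x +
        K * (transition n ^ (t + T)) (ind fun y => ¬ Consensus y) x := by
    intro t
    have h1 := hbound t
    have e4 : a / n * (n * average x) = a * average x := by field_simp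
    simp only [g, h] at h1
    rw [map_sub, map_add, map_add, map_smul, map_smul, map_smul, transition_pow_const hn,
      transition_pow_opinionSum hn] at h1
    simp only [Pi.sub_apply, Pi.add_apply, Pi.smul_apply, smul_eq_mul] at h1
    rw [opinionSum_eq hn, e4] at h1
    have := mul_le_mul_of_nonneg_left (transition_pow_totalGap_antitone hn i t T x)
      (show 0 ≤ 2 / (n : ℝ) by positivity)
    linarith
  -- The gap is frozen at its value at time `T` by the supermartingale property; letting `t → ∞`
  -- removes the non-consensus term.
  have l1 := (((tendsto_winProb hn x j).comp (tendsto_add_atTop_nat T)).sub_const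
    (a * average x + b)).abs
  have l2 := ((hcons.comp (tendsto_add_atTop_nat T)).const_mul K).const_add
    (2 / n * (transition n ^ T) (totalGap i) x)
  have := le_of_tendsto_of_tendsto' l1 l2 hbound'
  simpa using this

/-! ### Expected completion time -/

/-- Partial sums of the harmonic series. -/
noncomputable def harmonicSum (a : ℕ) : ℝ := ∑ b ∈ Finset.range a, 1 / ((b : ℝ) + 1)

lemma harmonicSum_succ (a : ℕ) : harmonicSum (a + 1) = harmonicSum a + 1 / ((a : ℝ) + 1) :=
  Finset.sum_range_succ _ _

lemma harmonicSum_mono {a b : ℕ} (h : a ≤ b) : harmonicSum a ≤ harmonicSum b :=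
  Finset.sum_le_sum_of_subset_of_nonneg (Finset.range_mono h) fun _ _ _ => by positivity

/-- Each of the `n - a` missing terms is at most `1 / (a + 1)`. This gives the bound `n ^ 2` for the
potential. -/
lemma harmonicSum_sub_le {a n : ℕ} (h : a ≤ n) :
    a * (harmonicSum n - harmonicSum a) ≤ n - a := by
  induction n, h using Nat.le_induction with
  | base => simp
  | succ n hn ih =>
    rw [harmonicSum_succ]
    have h1 : (a : ℝ) * (1 / ((n : ℝ) + 1)) ≤ 1 := by
      rw [mul_one_div, div_le_one (by positivity)]
      have : (a : ℝ) ≤ n := by exact_mod_cast hn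
      linarith
    push_cast
    linarith

/-- The potential of `a` holders of one of two opinions; its second difference is `- n / a`. -/
noncomputable def potential (n a : ℕ) : ℝ := n * (a * (1 + harmonicSum n - harmonicSum a))

lemma potential_zero (n : ℕ) : potential n 0 = 0 := by simp [potential]

lemma potential_nonneg {n a : ℕ} (h : a ≤ n) : 0 ≤ potential n a := by
  have := harmonicSum_mono h
  unfold potential
  have : 0 ≤ 1 + harmonicSum n - harmonicSum a := by linarith
  positivity

lemma potential_le {n a : ℕ} (h : a ≤ n) : potential n a ≤ (n : ℝ) ^ 2 := by
  have h1 := harmonicSum_sub_le h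
  unfold potential
  rw [sq]
  refine mul_le_mul_of_nonneg_left ?_ (by positivity)
  linarith

lemma potential_second_difference (n a : ℕ) :
    potential n (a + 2) + potential n a - 2 * potential n (a + 1) = - (n / ((a : ℝ) + 1)) := by
  unfold potential
  rw [harmonicSum_succ, harmonicSum_succ]
  push_cast
  have : (a : ℝ) + 1 + 1 ≠ 0 := by positivity
  field_simp
  ring

lemma count_step {n : ℕ} (j : ℤ) (x : Fin n → ℤ) (v w : Fin n) :
    (count j (step x (v, w)) : ℝ) =
      count j x + (delta j (nudge (x v) (x w)) - delta j (x v)) := by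
  rw [count_eq_total, total_step, ← count_eq_total]

/-- The potential of an opinion vector with the two opinions `m` and `m + 1`. -/
noncomputable def twoPotential {n : ℕ} (m : ℤ) (x : Fin n → ℤ) : ℝ :=
  potential n (count m x) + potential n (count (m + 1) x)

lemma twoPotential_step {n : ℕ} {m : ℤ} {x : Fin n → ℤ} (hx : InRange m (m + 1) x)
    (v w : Fin n) :
    twoPotential m (step x (v, w)) - twoPotential m x =
      delta m (x v) * delta (m + 1) (x w) *
        (potential n (count m x - 1) + potential n (count (m + 1) x + 1) - twoPotential m x) +
      delta (m + 1) (x v) * delta m (x w) *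
        (potential n (count m x + 1) + potential n (count (m + 1) x - 1) - twoPotential m x) := by
  have h1 := count_step m x v w
  have h2 := count_step (m + 1) x v w
  have hv : x v = m ∨ x v = m + 1 := by have := hx v; omega
  have hw : x w = m ∨ x w = m + 1 := by have := hx w; omega
  unfold delta nudge at *
  rcases hv with hv | hv <;> rcases hw with hw | hw <;> rw [hv, hw] at h1 h2 ⊢ <;>
    norm_num at h1 h2 ⊢
  · simp [twoPotential, h1, h2]
  · have : 0 < count m x := count_pos.2 ⟨v, hv⟩
    have e1 : count m (step x (v, w)) = count m x - 1 := by
      have : ((count m (step x (v, w)) + 1 : ℕ) : ℝ) = (count m x : ℕ) := by push_cast; linarith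
      have : count m (step x (v, w)) + 1 = count m x := by exact_mod_cast this
      omega
    have e2 : count (m + 1) (step x (v, w)) = count (m + 1) x + 1 := by exact_mod_cast h2
    rw [twoPotential, e1, e2]
  · have : 0 < count (m + 1) x := count_pos.2 ⟨v, hv⟩
    have e1 : count (m + 1) (step x (v, w)) = count (m + 1) x - 1 := by
      have : ((count (m + 1) (step x (v, w)) + 1 : ℕ) : ℝ) = (count (m + 1) x : ℕ) := by
        push_cast; linarith
      have : count (m + 1) (step x (v, w)) + 1 = count (m + 1) x := by exact_mod_cast this
      omega
    have e2 : count m (step x (v, w)) = count m x + 1 := by exact_mod_cast h1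
    rw [twoPotential, e1, e2]
  · simp [twoPotential, h1, h2]

lemma consensus_of_count_eq_zero {n : ℕ} {m : ℤ} {x : Fin n → ℤ} (hx : InRange m (m + 1) x)
    (h : count m x = 0 ∨ count (m + 1) x = 0) : Consensus x := by
  intro v w
  rcases h with h | h
  · have h1 := hx.of_count_min_eq_zero h v
    have h2 := hx.of_count_min_eq_zero h w
    omega
  · have h1 := hx.of_count_max_eq_zero h v
    have h2 := hx.of_count_max_eq_zero h w
    omega

/-- With counts $a,b>0$, each of the moves $a\to a\pm1$ has probability $ab/(n(n-1))$. The second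
differences turn the drift into $-ab(n/a+n/b)/(n(n-1))=-n^2/(n(n-1))\le-1$. -/
lemma transition_twoPotential_le {n : ℕ} (hn : 2 ≤ n) {m : ℤ} {x : Fin n → ℤ}
    (hx : InRange m (m + 1) x) :
    transition n (twoPotential m) x ≤ twoPotential m x - ind (fun y => ¬ Consensus y) x := by
  have h := transition_sub_self hn (twoPotential m) x
  have hp := pairs_pos hn
  rw [Finset.sum_congr rfl fun v _ => Finset.sum_congr rfl fun w _ => twoPotential_step hx v w]
    at h
  simp only [Finset.sum_add_distrib, ← Finset.sum_mul, sum_delta_mul_delta] at h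
  have hab := count_add_eq hx
  have hcons := consensus_of_count_eq_zero hx
  unfold twoPotential at *
  generalize count m x = a at *
  generalize count (m + 1) x = b at *
  rcases Nat.eq_zero_or_pos a with rfl | ha
  · have : ind (fun y : Fin n → ℤ => ¬ Consensus y) x = 0 := by simp [ind, hcons (Or.inl rfl)]
    simp at h
    rw [this]
    linarith
  rcases Nat.eq_zero_or_pos b with rfl | hb
  · have : ind (fun y : Fin n → ℤ => ¬ Consensus y) x = 0 := by simp [ind, hcons (Or.inr rfl)]
    simp at h
    rw [this]
    linarith
  obtain ⟨a, rfl⟩ := Nat.exists_eq_succ_of_ne_zero ha.ne'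
  obtain ⟨b, rfl⟩ := Nat.exists_eq_succ_of_ne_zero hb.ne'
  have d1 := potential_second_difference n a
  have d2 := potential_second_difference n b
  simp only [Nat.succ_eq_add_one, Nat.add_sub_cancel] at *
  have e : (((a + 1 : ℕ) : ℝ) * ((b + 1 : ℕ) : ℝ) * (potential n a + potential n (b + 1 + 1) -
      (potential n (a + 1) + potential n (b + 1))) + ((b + 1 : ℕ) : ℝ) * ((a + 1 : ℕ) : ℝ) *
      (potential n (a + 1 + 1) + potential n b - (potential n (a + 1) + potential n (b + 1)))) =
      - (n : ℝ) ^ 2 := by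
    have : (((a + 1 : ℕ) : ℝ) * ((b + 1 : ℕ) : ℝ) * (potential n a + potential n (b + 1 + 1) -
      (potential n (a + 1) + potential n (b + 1))) + ((b + 1 : ℕ) : ℝ) * ((a + 1 : ℕ) : ℝ) *
      (potential n (a + 1 + 1) + potential n b - (potential n (a + 1) + potential n (b + 1)))) =
      ((a : ℝ) + 1) * (b + 1) * (-(n / ((a : ℝ) + 1)) + -(n / ((b : ℝ) + 1))) := by
      rw [← d1, ← d2]; push_cast; ring
    rw [this, ← hab]
    push_cast
    field_simp
    ring
  rw [e] at h
  have h1 : -(n : ℝ) ^ 2 / ((n : ℝ) * (n - 1)) ≤ -1 := by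
    rw [div_le_iff₀ hp]
    have : (0 : ℝ) ≤ n := by positivity
    nlinarith
  have := ind_le_one (fun y => ¬ Consensus y) x
  linarith

lemma twoPotential_nonneg {n : ℕ} (m : ℤ) (x : Fin n → ℤ) : 0 ≤ twoPotential m x :=
  add_nonneg (potential_nonneg (count_le _ _)) (potential_nonneg (count_le _ _))

lemma twoPotential_le {n : ℕ} (m : ℤ) (x : Fin n → ℤ) : twoPotential m x ≤ 2 * (n : ℝ) ^ 2 := by
  have h1 := potential_le (count_le m x)
  have h2 := potential_le (count_le (m + 1) x)
  unfold twoPotential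
  linarith

/-! ### A potential for three consecutive opinions -/

/-- A concave function of the product of the numbers of holders of the two extreme opinions. -/
noncomputable def extremePotential (z : ℝ) : ℝ := if z < 1 then 0 else 3 - 2 / √z

lemma extremePotential_nonneg (z : ℝ) : 0 ≤ extremePotential z := by
  unfold extremePotential
  split_ifs with h
  · exact le_rfl
  · push Not at h
    have h1 : 1 ≤ √z := Real.one_le_sqrt.2 h
    have : 2 / √z ≤ 2 := div_le_self (by norm_num) h1
    linarith

lemma extremePotential_le (z : ℝ) : extremePotential z ≤ 3 := by
  unfold extremePotential
  split_ifs with h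
  · norm_num
  · have : 0 ≤ 2 / √z := by positivity
    linarith

/-- For `y ≥ 1` this is concavity of $3-2/\sqrt y$. At `y = 0` the tangent line has the value
$3(1-1/\sqrt z)\ge0$; the constant $3$ is the least for which this holds for all $z\ge1$. Products
of counts take no value strictly between $0$ and $1$. -/
lemma extremePotential_le_tangent {z y : ℝ} (hz : 1 ≤ z) (hy : y = 0 ∨ 1 ≤ y) :
    extremePotential y ≤ extremePotential z + (y - z) * (1 / (z * √z)) := by
  have h1 : 1 ≤ √z := Real.one_le_sqrt.2 hz
  have hzz : √z * √z = z := Real.mul_self_sqrt (by linarith)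
  have hz' : extremePotential z = 3 - 2 / √z := if_neg (by linarith)
  rw [hz']
  generalize √z = p at *
  subst hzz
  have hp : 0 < p := by linarith
  rcases hy with rfl | hy
  · rw [extremePotential, if_pos one_pos]
    have e : 3 - 2 / p + (0 - p * p) * (1 / (p * p * p)) = 3 * (1 - 1 / p) := by field_simp; ring
    rw [e]
    have : 1 / p ≤ 1 := by rw [div_le_one hp]; exact h1
    linarith
  · have h2 : 1 ≤ √y := Real.one_le_sqrt.2 hy
    have hyy : √y * √y = y := Real.mul_self_sqrt (by linarith)
    rw [extremePotential, if_neg (by linarith)]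
    generalize √y = q at *
    subst hyy
    have hq : 0 < q := by linarith
    have e : 3 - 2 / p + (q * q - p * p) * (1 / (p * p * p)) - (3 - 2 / q) =
        (q - p) ^ 2 * (q + 2 * p) / (p ^ 3 * q) := by field_simp; ring
    have : 0 ≤ (q - p) ^ 2 * (q + 2 * p) / (p ^ 3 * q) := by positivity
    linarith

lemma extremes_eq_zero_or_one_le {n : ℕ} (m M : ℤ) (x : Fin n → ℤ) :
    extremes m M x = 0 ∨ 1 ≤ extremes m M x := by
  unfold extremes
  rcases Nat.eq_zero_or_pos (count m x * count M x) with h | h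
  · left; exact_mod_cast h
  · right; exact_mod_cast h

/-- The potential of an opinion vector with the three opinions `m`, `m + 1` and `m + 2`. -/
noncomputable def threePotential {n : ℕ} (m : ℤ) (x : Fin n → ℤ) : ℝ :=
  if count m x = 0 then twoPotential (m + 1) x
  else if count (m + 2) x = 0 then twoPotential m x
  else (n : ℝ) ^ 2 / 2 * extremePotential (extremes m (m + 2) x) + 2 * (n : ℝ) ^ 2

lemma threePotential_nonneg {n : ℕ} (m : ℤ) (x : Fin n → ℤ) : 0 ≤ threePotential m x := by
  have := extremePotential_nonneg (extremes m (m + 2) x)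
  unfold threePotential
  split_ifs
  · exact twoPotential_nonneg _ _
  · exact twoPotential_nonneg _ _
  · positivity

/-- The summand $2n^2$ dominates the two-opinion potential, so a single formula bounds the potential
from above even when a step eliminates an extreme opinion. -/
lemma threePotential_le_add {n : ℕ} (m : ℤ) (x : Fin n → ℤ) :
    threePotential m x ≤
      (n : ℝ) ^ 2 / 2 * extremePotential (extremes m (m + 2) x) + 2 * (n : ℝ) ^ 2 := by
  have h : 0 ≤ (n : ℝ) ^ 2 / 2 * extremePotential (extremes m (m + 2) x) :=
    mul_nonneg (by positivity) (extremePotential_nonneg _)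
  unfold threePotential
  split_ifs
  · linarith [twoPotential_le (m + 1) x]
  · linarith [twoPotential_le m x]
  · exact le_rfl

lemma threePotential_le {n : ℕ} (m : ℤ) (x : Fin n → ℤ) :
    threePotential m x ≤ 7 / 2 * (n : ℝ) ^ 2 := by
  have h1 := threePotential_le_add m x
  have h2 := mul_le_mul_of_nonneg_left (extremePotential_le (extremes m (m + 2) x))
    (show 0 ≤ (n : ℝ) ^ 2 / 2 by positivity)
  linarith

lemma threePotential_eq_right {n : ℕ} {m : ℤ} {x : Fin n → ℤ} (hx : InRange (m + 1) (m + 2) x) :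
    threePotential m x = twoPotential (m + 1) x := by
  refine if_pos ?_
  by_contra h
  obtain ⟨v, hv⟩ := count_pos.1 (Nat.pos_of_ne_zero h)
  have := hx v
  omega

lemma threePotential_eq_left {n : ℕ} {m : ℤ} {x : Fin n → ℤ} (hx : InRange m (m + 1) x) :
    threePotential m x = twoPotential m x := by
  have h2 : count (m + 2) x = 0 := by
    by_contra h
    obtain ⟨v, hv⟩ := count_pos.1 (Nat.pos_of_ne_zero h)
    have := hx v
    omega
  unfold threePotential
  split_ifs with h
  -- Here only `m + 1` is held; the two branches agree because `potential n 0 = 0`.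
  · unfold twoPotential
    rw [h, show m + 1 + 1 = m + 2 by ring, h2, potential_zero]
    ring
  · rfl

lemma transition_threePotential_le {n : ℕ} (hn : 2 ≤ n) {m : ℤ} {x : Fin n → ℤ}
    (hx : InRange m (m + 2) x) :
    transition n (threePotential m) x ≤
      threePotential m x - ind (fun y => ¬ Consensus y) x := by
  have hcongr : ∀ {a b : ℤ} {g h : (Fin n → ℤ) → ℝ}, InRange a b x →
      (∀ y : Fin n → ℤ, InRange a b y → g y = h y) → transition n g x = transition n h x := by
    intro a b g h hxab hgh
    exact le_antisymm (transition_mono (invariant_inRange a b) (fun y hy => (hgh y hy).le) hxab)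
      (transition_mono (invariant_inRange a b) (fun y hy => (hgh y hy).ge) hxab)
  by_cases h1 : count m x = 0
  · have hx' := hx.of_count_min_eq_zero h1
    rw [hcongr hx' fun y hy => threePotential_eq_right hy, threePotential_eq_right hx']
    exact transition_twoPotential_le hn (by rwa [show m + 1 + 1 = m + 2 by ring])
  by_cases h2 : count (m + 2) x = 0
  · have hx' : InRange m (m + 1) x := by
      have := hx.of_count_max_eq_zero h2
      rwa [show m + 2 - 1 = m + 1 by ring] at this
    rw [hcongr hx' fun y hy => threePotential_eq_left hy, threePotential_eq_left hx']
    exact transition_twoPotential_le hn hx'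
  have hz : 1 ≤ extremes m (m + 2) x := by
    unfold extremes
    exact_mod_cast Nat.mul_pos (Nat.pos_of_ne_zero h1) (Nat.pos_of_ne_zero h2)
  have hG : threePotential m x =
      (n : ℝ) ^ 2 / 2 * extremePotential (extremes m (m + 2) x) + 2 * (n : ℝ) ^ 2 := by
    unfold threePotential
    rw [if_neg h1, if_neg h2]
  have hthree := transition_extremes_three hn hx
  have hP : transition n (threePotential m) x ≤ (n : ℝ) ^ 2 / 2 *
      (extremePotential (extremes m (m + 2) x) +
        (transition n (extremes m (m + 2)) x - extremes m (m + 2) x) *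
          (1 / (extremes m (m + 2) x * √(extremes m (m + 2) x)))) + 2 * (n : ℝ) ^ 2 := by
    set z := extremes m (m + 2) x
    set s := 1 / (z * √z)
    have := transition_mono (I := fun _ => True) (fun _ _ _ => trivial)
      (g := threePotential m) (h := ((n : ℝ) ^ 2 / 2 * s) • extremes m (m + 2) +
        fun _ => (n : ℝ) ^ 2 / 2 * (extremePotential z - z * s) + 2 * (n : ℝ) ^ 2)
      (fun y _ => by
        have h3 := threePotential_le_add m y
        have h4 := mul_le_mul_of_nonneg_left
          (extremePotential_le_tangent hz (extremes_eq_zero_or_one_le m (m + 2) y))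
          (show 0 ≤ (n : ℝ) ^ 2 / 2 by positivity)
        simp only [Pi.add_apply, Pi.smul_apply, smul_eq_mul]
        linarith) (x := x) trivial
    rw [map_add, map_smul, transition_const hn] at this
    simp only [Pi.add_apply, Pi.smul_apply, smul_eq_mul] at this
    linarith
  -- With $z=AD$, the drift $-z(A+D)/(n(n-1))$ times the slope $z^{-3/2}$ is at most $-2/(n(n-1))$,
  -- since $A+D\ge2\sqrt z$.
  have hdrop : (n : ℝ) ^ 2 / 2 * ((transition n (extremes m (m + 2)) x - extremes m (m + 2) x) *
      (1 / (extremes m (m + 2) x * √(extremes m (m + 2) x)))) ≤ -1 := by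
    rw [hthree]
    set z := extremes m (m + 2) x with hzdef
    have hzpos : 0 < z := by linarith
    have hs : 0 < √z := Real.sqrt_pos.2 hzpos
    have hsum : 2 * √z ≤ (count m x : ℝ) + count (m + 2) x := by
      refine le_of_sq_le_sq ?_ (by positivity)
      rw [mul_pow, Real.sq_sqrt hzpos.le, hzdef, extremes]
      nlinarith [sq_nonneg ((count m x : ℝ) - count (m + 2) x)]
    generalize (count m x : ℝ) + count (m + 2) x = r at *
    have hp := pairs_pos hn
    have e : (n : ℝ) ^ 2 / 2 * ((z - z * r / ((n : ℝ) * (n - 1)) - z) * (1 / (z * √z))) =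
        - ((n : ℝ) ^ 2 * r / (2 * ((n : ℝ) * (n - 1)) * √z)) := by
      field_simp
      ring
    rw [e]
    have : 1 ≤ (n : ℝ) ^ 2 * r / (2 * ((n : ℝ) * (n - 1)) * √z) := by
      rw [le_div_iff₀ (by positivity)]
      have h3 : (n : ℝ) ^ 2 * (2 * √z) ≤ (n : ℝ) ^ 2 * r :=
        mul_le_mul_of_nonneg_left hsum (by positivity)
      have h4 : 0 ≤ (n : ℝ) * (2 * √z) := by positivity
      nlinarith
    linarith
  have := ind_le_one (fun y => ¬ Consensus y) x
  rw [hG]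
  linarith

lemma sum_transition_pow_not_consensus_le {n : ℕ} (hn : 2 ≤ n) {x : Fin n → ℤ}
    (hx : AtMostThreeConsecutive x) (N : ℕ) :
    ∑ t ∈ Finset.range N, (transition n ^ t) (ind fun y => ¬ Consensus y) x ≤
      7 / 2 * (n : ℝ) ^ 2 := by
  obtain ⟨m, hm⟩ := hx.exists_inRange
  exact (sum_transition_pow_le_of_drift (invariant_inRange m (m + 2))
    (fun y _ => threePotential_nonneg m y) (fun y hy => transition_threePotential_le hn hy) N x
    hm).trans (threePotential_le m x)

/-! ### Completion time from arbitrary initial opinions -/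

lemma transition_pow_ind_mem {n : ℕ} (hn : 2 ≤ n) (A : (Fin n → ℤ) → Prop) (t : ℕ)
    (x : Fin n → ℤ) : 0 ≤ (transition n ^ t) (ind A) x ∧ (transition n ^ t) (ind A) x ≤ 1 := by
  have hI : Invariant fun _ : Fin n → ℤ => True := fun _ _ _ => trivial
  constructor
  · have := transition_pow_mono hI (g := fun _ => 0) (h := ind A)
      (fun y _ => ind_nonneg A y) t x trivial
    rwa [transition_pow_const hn] at this
  · have := transition_pow_mono hI (g := ind A) (h := fun _ => 1)
      (fun y _ => ind_le_one A y) t x trivial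
    rwa [transition_pow_const hn] at this

/-- If after time `T₀` more than three consecutive values are needed with probability at most `1/2`,
uniformly over the initial opinions, then the expected completion time is at most
`2 T₀ + 7 n ^ 2`. -/
lemma sum_transition_pow_not_consensus_le_of_inRange {n : ℕ} (hn : 2 ≤ n) {a b : ℤ} {T₀ : ℕ}
    (hT : ∀ x : Fin n → ℤ, InRange a b x →
      (transition n ^ T₀) (ind fun y => ¬ AtMostThreeConsecutive y) x ≤ 1 / 2)
    (N : ℕ) {x : Fin n → ℤ} (hx : InRange a b x) :
    ∑ t ∈ Finset.range N, (transition n ^ t) (ind fun y => ¬ Consensus y) x ≤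
      2 * T₀ + 7 * (n : ℝ) ^ 2 := by
  set f : (Fin n → ℤ) → ℝ := fun y =>
    ∑ t ∈ Finset.range N, (transition n ^ t) (ind fun y => ¬ Consensus y) y with hf
  have hfN : ∀ y, f y ≤ N := by
    intro y
    have := Finset.sum_le_card_nsmul (Finset.range N)
      (fun t => (transition n ^ t) (ind fun y => ¬ Consensus y) y) 1
      fun t _ => (transition_pow_ind_mem hn _ t y).2
    simpa using this
  have hf0 : ∀ y, 0 ≤ f y := fun y =>
    Finset.sum_nonneg fun t _ => (transition_pow_ind_mem hn _ t y).1
  have hf' : f = ∑ t ∈ Finset.range N, (transition n ^ t) (ind fun y => ¬ Consensus y) := by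
    funext y; simp [hf]
  have hfirst : ∀ y, f y ≤ T₀ + (transition n ^ T₀) f y := by
    intro y
    have h1 : f y ≤ ∑ t ∈ Finset.range (T₀ + N),
        (transition n ^ t) (ind fun y => ¬ Consensus y) y :=
      Finset.sum_le_sum_of_subset_of_nonneg (Finset.range_mono (by omega))
        fun t _ _ => (transition_pow_ind_mem hn _ t y).1
    rw [Finset.sum_range_add] at h1
    have h2 := Finset.sum_le_card_nsmul (Finset.range T₀)
      (fun t => (transition n ^ t) (ind fun y => ¬ Consensus y) y) 1
      fun t _ => (transition_pow_ind_mem hn _ t y).2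
    have h3 : (transition n ^ T₀) f y = ∑ t ∈ Finset.range N,
        (transition n ^ (T₀ + t)) (ind fun y => ¬ Consensus y) y := by
      rw [hf', map_sum, Finset.sum_apply]
      simp_rw [pow_add, Module.End.mul_apply]
    rw [h3]
    simp only [Finset.card_range, nsmul_eq_mul, mul_one] at h2
    linarith
  -- Restart at time `T₀`: three-value states cost at most `7 / 2 * n ^ 2`, the others at most `U`
  -- and have probability at most `1 / 2`.
  have himp : ∀ U : ℝ, 0 ≤ U → (∀ y, InRange a b y → f y ≤ U) →
      ∀ y, InRange a b y → f y ≤ T₀ + 7 / 2 * (n : ℝ) ^ 2 + U / 2 := by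
    intro U hU0 hU y hy
    have h1 := transition_pow_mono (invariant_inRange (n := n) a b) (g := f)
      (h := (fun _ => 7 / 2 * (n : ℝ) ^ 2) + U • ind fun y => ¬ AtMostThreeConsecutive y)
      (fun z hz => by
        simp only [Pi.add_apply, Pi.smul_apply, smul_eq_mul]
        by_cases h3 : AtMostThreeConsecutive z
        · have := sum_transition_pow_not_consensus_le hn h3 N
          have := mul_nonneg hU0 (ind_nonneg (fun y => ¬ AtMostThreeConsecutive y) z)
          simp only [hf]
          linarith
        · have e : ind (fun y : Fin n → ℤ => ¬ AtMostThreeConsecutive y) z = 1 := by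
            simp [ind, h3]
          have : 0 ≤ 7 / 2 * (n : ℝ) ^ 2 := by positivity
          rw [e]
          linarith [hU z hz]) T₀ y hy
    rw [map_add, map_smul, transition_pow_const hn] at h1
    simp only [Pi.add_apply, Pi.smul_apply, smul_eq_mul] at h1
    have h2 := mul_le_mul_of_nonneg_left (hT y hy) hU0
    linarith [hfirst y]
  have : Nonempty {y : Fin n → ℤ // InRange a b y} := ⟨⟨x, hx⟩⟩
  have hbdd : BddAbove (Set.range fun y : {y : Fin n → ℤ // InRange a b y} => f y.1) :=
    ⟨N, by rintro _ ⟨y, rfl⟩; exact hfN _⟩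
  -- Truncation at `N` makes the supremum finite, so `U / 2` may be subtracted from both sides of
  -- `hU'`.
  set U : ℝ := ⨆ y : {y : Fin n → ℤ // InRange a b y}, f y.1
  have hU : ∀ y, InRange a b y → f y ≤ U := fun y hy => le_ciSup hbdd ⟨y, hy⟩
  have hU0 : 0 ≤ U := (hf0 x).trans (hU x hx)
  have hU' : U ≤ T₀ + 7 / 2 * (n : ℝ) ^ 2 + U / 2 :=
    ciSup_le fun y => himp U hU0 hU y.1 y.2
  have := hU x hx
  linarith

lemma tendsto_transition_pow_not_consensus {n : ℕ} (hn : 2 ≤ n) {x : Fin n → ℤ} {B : ℝ}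
    (hB : ∀ N, ∑ t ∈ Finset.range N, (transition n ^ t) (ind fun y => ¬ Consensus y) x ≤ B) :
    Tendsto (fun t => (transition n ^ t) (ind fun y => ¬ Consensus y) x) atTop (𝓝 0) :=
  (summable_of_sum_range_le (fun t => (transition_pow_ind_mem hn _ t x).1)
    hB).tendsto_atTop_zero

/-- Every time before the first consensus contributes `1`; without consensus the sum is infinite. -/
lemma completionTime_le_tsum {n : ℕ} (x : Fin n → ℤ) (ω : ℕ → Fin n × Fin n) :
    completionTime x ω ≤
      ∑' t, {ω | ¬ Consensus (opinions x ω t)}.indicator (fun _ => (1 : ℝ≥0∞)) ω := by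
  classical
  by_cases h : ∃ t, Consensus (opinions x ω t)
  · have h1 : completionTime x ω ≤ (Nat.find h : ℝ≥0∞) :=
      iInf₂_le (Nat.find h) (Nat.find_spec h)
    refine h1.trans ?_
    have h2 : ∑ t ∈ Finset.range (Nat.find h),
        {ω | ¬ Consensus (opinions x ω t)}.indicator (fun _ => (1 : ℝ≥0∞)) ω = Nat.find h := by
      rw [Finset.sum_congr rfl (g := fun _ => (1 : ℝ≥0∞))]
      · simp
      · intro t ht
        exact Set.indicator_of_mem (s := {ω | ¬ Consensus (opinions x ω t)})
          (Nat.find_min h (Finset.mem_range.1 ht)) _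
    rw [← h2]
    exact ENNReal.sum_le_tsum _
  · push Not at h
    have h2 : ∀ t, {ω | ¬ Consensus (opinions x ω t)}.indicator (fun _ => (1 : ℝ≥0∞)) ω = 1 :=
      fun t => Set.indicator_of_mem (s := {ω | ¬ Consensus (opinions x ω t)}) (h t) _
    simp_rw [h2]
    rw [ENNReal.tsum_const_eq_top_of_ne_zero one_ne_zero]
    exact le_top

lemma lintegral_completionTime_le {n : ℕ} (hn : 2 ≤ n) {x : Fin n → ℤ} {B : ℝ}
    (hB : ∀ N, ∑ t ∈ Finset.range N, (transition n ^ t) (ind fun y => ¬ Consensus y) x ≤ B) :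
    ∫⁻ ω, completionTime x ω ∂completeLaw n ≤ ENNReal.ofReal B := by
  have := isProbabilityMeasure_completeLaw hn
  calc ∫⁻ ω, completionTime x ω ∂completeLaw n
      ≤ ∫⁻ ω, ∑' t, {ω | ¬ Consensus (opinions x ω t)}.indicator (fun _ => (1 : ℝ≥0∞)) ω
          ∂completeLaw n := lintegral_mono fun ω => completionTime_le_tsum x ω
    _ = ∑' t, completeLaw n {ω | ¬ Consensus (opinions x ω t)} := by
        rw [lintegral_tsum]
        · refine tsum_congr fun t => ?_
          exact lintegral_indicator_one (measurableSet_opinions x t fun y => ¬ Consensus y)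
        · intro t
          exact (measurable_const.indicator
            (measurableSet_opinions x t fun y => ¬ Consensus y)).aemeasurable
    _ = ∑' t, ENNReal.ofReal ((transition n ^ t) (ind fun y => ¬ Consensus y) x) := by
        refine tsum_congr fun t => ?_
        rw [← completeLaw_real_opinions hn x t fun y => ¬ Consensus y, ofReal_measureReal]
    _ ≤ ENNReal.ofReal B := by
        refine ENNReal.tsum_le_of_sum_range_le fun N => ?_
        rw [← ENNReal.ofReal_sum_of_nonneg fun t _ => (transition_pow_ind_mem hn _ t x).1]
        exact ENNReal.ofReal_le_ofReal (hB N)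

/-! ### Asymptotics -/

/-- The length of the phase in which one of the extreme opinions disappears. -/
noncomputable def phaseLength (n : ℕ) : ℕ := ⌈4 * (n * Real.log n)⌉₊

lemma one_sub_div_pow_phaseLength_le {n : ℕ} (hn : 2 ≤ n) {δ : ℝ} (hδ0 : 0 ≤ δ) (hδ1 : δ ≤ 1) :
    (1 - δ / n) ^ phaseLength n ≤ Real.exp (-(4 * δ * Real.log n)) := by
  have h2 : (2 : ℝ) ≤ n := by exact_mod_cast hn
  have hT : 4 * (n * Real.log n) ≤ phaseLength n := Nat.le_ceil _
  calc (1 - δ / n) ^ phaseLength n ≤ Real.exp (-(δ / n)) ^ phaseLength n :=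
        pow_le_pow_left₀ (one_sub_div_nonneg hn hδ1) (Real.one_sub_le_exp_neg _) _
    _ = Real.exp (-(δ / n * phaseLength n)) := by rw [← Real.exp_nat_mul]; congr 1; ring
    _ ≤ _ := by
        rw [Real.exp_le_exp, neg_le_neg_iff]
        have h := mul_le_mul_of_nonneg_left hT (show 0 ≤ δ / (n : ℝ) by positivity)
        have e : δ / n * (4 * (n * Real.log n)) = 4 * δ * Real.log n := by field_simp
        linarith

/-- This fixes the factor `4` in `phaseLength`: $n^{-4}n^2=n^{-2}$ leaves failure probability
$O(1/n)$ after $k=O(n)$ phases, enough to absorb the crude gap bound $nk$. -/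
lemma one_sub_one_div_pow_phaseLength_mul_sq_le {n : ℕ} (hn : 2 ≤ n) :
    (1 - 1 / (n : ℝ)) ^ phaseLength n * (n : ℝ) ^ 2 ≤ 1 / (n : ℝ) ^ 2 := by
  have h2 : (2 : ℝ) ≤ n := by exact_mod_cast hn
  have h := one_sub_div_pow_phaseLength_le hn zero_le_one le_rfl
  have e : Real.exp (-(4 * 1 * Real.log n)) = 1 / (n : ℝ) ^ 4 := by
    rw [Real.exp_neg, mul_one, show (4 : ℝ) * Real.log n = (4 : ℕ) * Real.log n by norm_num,
      Real.exp_nat_mul, Real.exp_log (by linarith), one_div]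
  rw [e] at h
  calc _ ≤ 1 / (n : ℝ) ^ 4 * (n : ℝ) ^ 2 := mul_le_mul_of_nonneg_right h (by positivity)
    _ = _ := by field_simp

lemma mul_phaseLength_le {n : ℕ} (hn : 1 ≤ n) (hlog : 1 ≤ Real.log n) (k : ℕ) :
    ((k * phaseLength n : ℕ) : ℝ) ≤ 5 * (n * k * Real.log n) := by
  have h1 : (1 : ℝ) ≤ n := by exact_mod_cast hn
  have h2 : 1 ≤ (n : ℝ) * Real.log n := by nlinarith
  have hT : (phaseLength n : ℝ) < 4 * (n * Real.log n) + 1 := Nat.ceil_lt_add_one (by positivity)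
  have h3 : (phaseLength n : ℝ) ≤ 5 * (n * Real.log n) := by linarith
  have := mul_le_mul_of_nonneg_left h3 (Nat.cast_nonneg (α := ℝ) k)
  push_cast
  linarith

section

variable {k : ℕ → ℕ} {x : ∀ n : ℕ, Fin n → ℤ}

/-- What later estimates take from the growth of `k`: since $k\log n=o(n)$, all phases together last
$o(n^2)$ steps, too few for the average to move by a constant. -/
lemma eventually_mul_log_le
    (hk : (fun n : ℕ => (k n : ℝ)) =o[atTop] fun n : ℕ => (n : ℝ) / Real.log n ^ 2)
    {η : ℝ} (hη : 0 < η) :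
    ∀ᶠ n : ℕ in atTop, 2 ≤ n ∧ 1 ≤ Real.log n ∧ k n * Real.log n ≤ η * n ∧ k n ≤ η * n := by
  have hlog : ∀ᶠ n : ℕ in atTop, 1 ≤ Real.log n :=
    (Real.tendsto_log_atTop.comp tendsto_natCast_atTop_atTop).eventually_ge_atTop 1
  filter_upwards [hk.bound hη, hlog, eventually_ge_atTop 2] with n h1 h2 h3
  rw [Real.norm_of_nonneg (by positivity), Real.norm_of_nonneg (by positivity)] at h1
  have hL : 0 < Real.log n := by linarith
  have hk0 : (0 : ℝ) ≤ k n := by positivity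
  rw [← mul_div_assoc, le_div_iff₀ (by positivity)] at h1
  have h5 : k n * Real.log n ≤ η * n := by
    refine le_trans (mul_le_mul_of_nonneg_left ?_ hk0) h1
    nlinarith
  refine ⟨h3, h2, h5, le_trans ?_ h5⟩
  nlinarith

lemma not_three_bound_le {n k : ℕ} (hn : 2 ≤ n) {η : ℝ} (hη : 0 < η) (hkn : k ≤ η * n) :
    k * ((1 - 1 / (n : ℝ)) ^ phaseLength n * (n : ℝ) ^ 2) ≤ η / n := by
  have h2 : (2 : ℝ) ≤ n := by exact_mod_cast hn
  calc _ ≤ k * (1 / (n : ℝ) ^ 2) :=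
        mul_le_mul_of_nonneg_left (one_sub_one_div_pow_phaseLength_mul_sq_le hn) (by positivity)
    _ ≤ η * n * (1 / (n : ℝ) ^ 2) := mul_le_mul_of_nonneg_right hkn (by positivity)
    _ = η / n := by field_simp

lemma transition_pow_not_three_le_div {n k : ℕ} (hn : 2 ≤ n) {η : ℝ} (hη : 0 < η)
    (hkn : k ≤ η * n) {y : Fin n → ℤ} (hy : InRange 1 k y) :
    (transition n ^ (k * phaseLength n)) (ind fun y => ¬ AtMostThreeConsecutive y) y ≤ η / n :=
  (transition_pow_not_three_le hn _ k 1 y fun v => by have := hy v; omega).trans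
    (not_three_bound_le hn hη hkn)

lemma eventually_sum_not_consensus_le
    (hk : (fun n : ℕ => (k n : ℝ)) =o[atTop] fun n : ℕ => (n : ℝ) / Real.log n ^ 2)
    (hx : ∀ n v, 1 ≤ x n v ∧ x n v ≤ k n) :
    ∀ᶠ n in atTop, ∀ N, ∑ t ∈ Finset.range N,
      (transition n ^ t) (ind fun y => ¬ Consensus y) (x n) ≤ 9 * (n : ℝ) ^ 2 := by
  -- With $\eta=1/10$ the collapse takes $T_0\le n^2/2$ steps, so $2T_0+7n^2\le9n^2$.
  filter_upwards [eventually_mul_log_le hk (η := 1 / 10) (by norm_num)] with n hn N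
  obtain ⟨hn2, hlog, hkl, hkn⟩ := hn
  have h2 : (2 : ℝ) ≤ n := by exact_mod_cast hn2
  have h1 := sum_transition_pow_not_consensus_le_of_inRange hn2 (a := 1) (b := k n)
    (T₀ := k n * phaseLength n) (fun y hy => by
      refine (transition_pow_not_three_le_div hn2 (by norm_num) hkn hy).trans ?_
      rw [div_le_iff₀ (by linarith)]
      linarith) N (hx n)
  have h3 := mul_phaseLength_le (by omega) hlog (k n)
  have h4 := mul_le_mul_of_nonneg_left hkl (show (0 : ℝ) ≤ n by positivity)
  nlinarith

lemma eventually_totalGap_le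
    (hk : (fun n : ℕ => (k n : ℝ)) =o[atTop] fun n : ℕ => (n : ℝ) / Real.log n ^ 2)
    (hx : ∀ n v, 1 ≤ x n v ∧ x n v ≤ k n) {ε : ℝ} (hε0 : 0 < ε) (hε1 : ε ≤ 1) :
    ∀ᶠ n in atTop, ∀ i : ℤ, (i : ℝ) ≤ average (x n) → average (x n) ≤ i + 1 →
      2 / n * (transition n ^ (k n * phaseLength n + phaseLength n)) (totalGap i) (x n) ≤
        4 * ε := by
  -- The cutoffs below are $l=\varepsilon n$ and $\delta=\varepsilon$. Terms of size $\eta n^2$ are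
  -- divided by $2l$, so $\eta$ of order $\varepsilon^2$ makes them $O(\varepsilon n)$.
  set η : ℝ := ε ^ 2 / 20 with hηdef
  have hη : 0 < η := by positivity
  have hexp : ∀ᶠ n : ℕ in atTop, Real.exp (-(4 * ε * Real.log n)) ≤ η := by
    have h1 : Tendsto (fun n : ℕ => 4 * ε * Real.log n) atTop atTop :=
      (Real.tendsto_log_atTop.comp tendsto_natCast_atTop_atTop).const_mul_atTop (by positivity)
    exact (Real.tendsto_exp_neg_atTop_nhds_zero.comp h1).eventually_le_const hη
  filter_upwards [eventually_mul_log_le hk hη, hexp] with n hn hen i hic hci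
  obtain ⟨hn2, hlog, hkl, hkn⟩ := hn
  have h2 : (2 : ℝ) ≤ n := by exact_mod_cast hn2
  have hpos : (0 : ℝ) < n := by linarith
  have h := transition_pow_totalGap_le_of_average hn2 hic hci (l := ε * n) (by positivity) hε0.le
    hε1 (phaseLength n) (hx n)
  have hk1 : 1 ≤ k n := by
    have := hx n ⟨0, by omega⟩
    omega
  set T := phaseLength n
  have hkT : ((k n * T : ℕ) : ℝ) ≤ 5 * η * (n : ℝ) ^ 2 := by
    have h3 := mul_phaseLength_le (by omega) hlog (k n)
    have h4 := mul_le_mul_of_nonneg_left hkl hpos.le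
    calc ((k n * T : ℕ) : ℝ) ≤ _ := h3
      _ ≤ _ := by linarith
  have hT : (T : ℝ) ≤ 5 * η * (n : ℝ) ^ 2 := by
    refine le_trans ?_ hkT
    exact_mod_cast Nat.le_mul_of_pos_left T hk1
  have hδ := (one_sub_div_pow_phaseLength_le hn2 hε0.le hε1).trans hen
  have hδ2 := mul_le_mul_of_nonneg_right hδ (sq_nonneg (n : ℝ))
  have h3 : (n : ℝ) * k n * (k n * ((1 - 1 / (n : ℝ)) ^ T * (n : ℝ) ^ 2)) ≤ η ^ 2 * n := by
    calc _ ≤ (n : ℝ) * (η * n) * (η / n) := by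
          refine mul_le_mul (mul_le_mul_of_nonneg_left hkn hpos.le)
            (not_three_bound_le hn2 hη hkn) ?_ (by positivity)
          have := pow_nonneg (one_sub_div_nonneg hn2 le_rfl) T
          positivity
      _ = η ^ 2 * n := by field_simp
  have h4 : ((1 - ε / n) ^ T * (n : ℝ) ^ 2 + (ε * n) ^ 2 / 4 + T) / (2 * (ε * n)) ≤
      (6 * η + ε ^ 2 / 4) / (2 * ε) * n := by
    rw [div_le_iff₀ (by positivity)]
    have : (6 * η + ε ^ 2 / 4) / (2 * ε) * n * (2 * (ε * n)) =
        (6 * η + ε ^ 2 / 4) * (n : ℝ) ^ 2 := by field_simp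
    rw [this]
    linarith
  have h5 : ((k n * T : ℕ) : ℝ) / (2 * (ε * n)) ≤ 5 * η / (2 * ε) * n := by
    rw [div_le_iff₀ (by positivity)]
    have : 5 * η / (2 * ε) * n * (2 * (ε * n)) = 5 * η * (n : ℝ) ^ 2 := by field_simp
    rw [this]
    exact hkT
  have h6 : (transition n ^ (k n * T + T)) (totalGap i) (x n) ≤
      (ε + (6 * η + ε ^ 2 / 4) / (2 * ε) + 5 * η / (2 * ε) + η ^ 2) * n := by linarith
  have h7 := mul_le_mul_of_nonneg_left h6 (show 0 ≤ 2 / (n : ℝ) by positivity)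
  refine h7.trans ?_
  have e : 2 / (n : ℝ) * ((ε + (6 * η + ε ^ 2 / 4) / (2 * ε) + 5 * η / (2 * ε) + η ^ 2) * n) =
      2 * ε + ε * (16 / 20) + 2 * (ε ^ 2 / 20) ^ 2 := by
    rw [hηdef]
    field_simp
    ring
  rw [e]
  have h8 : ε ^ 2 ≤ ε := by nlinarith
  nlinarith

/-- Both functions agree on $\{i,i+1\}$; at distance $g\ge1$ from it the affine one is at most
$g+1\le2g$ in absolute value. -/
lemma abs_delta_sub_le (i w : ℤ) : |delta i w - (-1 * w + (i + 1))| ≤ 2 * gap i w := by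
  have h : |(if w = i then 1 else 0) - (-1 * w + (i + 1))| ≤ 2 * gap i w := by
    rw [abs_le]
    unfold gap
    constructor <;> split_ifs <;> omega
  have h' : ((|(if w = i then 1 else 0) - (-1 * w + (i + 1))| : ℤ) : ℝ) ≤ ((2 * gap i w : ℤ) : ℝ) :=
    Int.cast_le.2 h
  unfold delta
  push_cast at h'
  exact h'

lemma abs_delta_succ_sub_le (i w : ℤ) : |delta (i + 1) w - (1 * w + -i)| ≤ 2 * gap i w := by
  have h : |(if w = i + 1 then 1 else 0) - (1 * w + -i)| ≤ 2 * gap i w := by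
    rw [abs_le]
    unfold gap
    constructor <;> split_ifs <;> omega
  have h' : ((|(if w = i + 1 then 1 else 0) - (1 * w + -i)| : ℤ) : ℝ) ≤ ((2 * gap i w : ℤ) : ℝ) :=
    Int.cast_le.2 h
  unfold delta
  push_cast at h'
  exact h'

lemma eventually_abs_winProb_sub_le
    (hk : (fun n : ℕ => (k n : ℝ)) =o[atTop] fun n : ℕ => (n : ℝ) / Real.log n ^ 2)
    (hx : ∀ n v, 1 ≤ x n v ∧ x n v ≤ k n) {ε : ℝ} (hε : 0 < ε) :
    ∀ᶠ n in atTop, ∀ i : ℤ, (i : ℝ) ≤ average (x n) → average (x n) ≤ i + 1 →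
      |winProb (x n) i - (i + 1 - average (x n))| < ε ∧
        |winProb (x n) (i + 1) - (average (x n) - i)| < ε := by
  set ε' : ℝ := min 1 (ε / 8)
  have h0 : 0 < ε' := lt_min one_pos (by positivity)
  have h1 : ε' ≤ ε / 8 := min_le_right _ _
  filter_upwards [eventually_totalGap_le hk hx h0 (min_le_left _ _),
    eventually_sum_not_consensus_le hk hx, eventually_ge_atTop 2] with n hgap hsum hn i hic hci
  have hcons := tendsto_transition_pow_not_consensus hn hsum
  have hb := hgap i hic hci
  constructor
  · have := abs_winProb_sub_le hn (hx n) hcons (abs_delta_sub_le i)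
      (k n * phaseLength n + phaseLength n)
    rw [show (i : ℝ) + 1 - average (x n) = -1 * average (x n) + (i + 1) by ring]
    linarith
  · have := abs_winProb_sub_le hn (hx n) hcons (abs_delta_succ_sub_le i)
      (k n * phaseLength n + phaseLength n)
    rw [show average (x n) - (i : ℝ) = 1 * average (x n) + -i by ring]
    linarith

lemma tendsto_real_atMostThreeConsecutive
    (hk : (fun n : ℕ => (k n : ℝ)) =o[atTop] fun n : ℕ => (n : ℝ) / Real.log n ^ 2)
    (hx : ∀ n v, 1 ≤ x n v ∧ x n v ≤ k n) :
    Tendsto (fun n => (completeLaw n).real {ω | ∃ t : ℕ, (t : ℝ) ≤ 9 * (n * k n * Real.log n) ∧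
      AtMostThreeConsecutive (opinions (x n) ω t)}) atTop (𝓝 1) := by
  have hlim : Tendsto (fun n : ℕ => 1 - 1 / (n : ℝ)) atTop (𝓝 1) := by
    simpa using (tendsto_one_div_atTop_nhds_zero_nat (𝕜 := ℝ)).const_sub 1
  refine tendsto_of_tendsto_of_tendsto_of_le_of_le' hlim tendsto_const_nhds ?_ ?_
  · filter_upwards [eventually_mul_log_le hk one_pos] with n hn
    obtain ⟨hn2, hlog, hkl, hkn⟩ := hn
    have := isProbabilityMeasure_completeLaw hn2
    have h1 := transition_pow_not_three_le_div hn2 one_pos hkn (hx n)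
    have e : ind (fun y : Fin n → ℤ => AtMostThreeConsecutive y) =
        (fun _ => 1) - ind fun y => ¬ AtMostThreeConsecutive y := by
      funext y
      simp only [ind, Pi.sub_apply]
      split_ifs <;> norm_num
    have h2 := completeLaw_real_opinions hn2 (x n) (k n * phaseLength n) AtMostThreeConsecutive
    rw [e, map_sub, transition_pow_const hn2, Pi.sub_apply] at h2
    calc 1 - 1 / (n : ℝ) ≤ (completeLaw n).real
          {ω | AtMostThreeConsecutive (opinions (x n) ω (k n * phaseLength n))} := by linarith
      _ ≤ _ := by
          refine measureReal_mono fun ω hω => ⟨k n * phaseLength n, ?_, hω⟩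
          refine (mul_phaseLength_le (by omega) hlog (k n)).trans ?_
          have : 0 ≤ (n : ℝ) * k n * Real.log n := by positivity
          linarith
  · filter_upwards [eventually_ge_atTop 2] with n hn
    have := isProbabilityMeasure_completeLaw hn
    exact measureReal_le_one

lemma isEquivalent_of_tendsto_sub {u v : ℕ → ℝ} (h : Tendsto (fun n => u n - v n) atTop (𝓝 0))
    (hv : ∃ δ : ℝ, 0 < δ ∧ ∀ᶠ n in atTop, δ ≤ v n) : u ~[atTop] v := by
  obtain ⟨δ, hδ, hv⟩ := hv
  have h1 : (u - v) =o[atTop] fun _ => (1 : ℝ) := (isLittleO_one_iff ℝ).2 h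
  refine h1.trans_isBigO (IsBigO.of_bound (1 / δ) ?_)
  filter_upwards [hv] with n hn
  rw [norm_one, Real.norm_of_nonneg (hδ.le.trans hn), one_div_mul_eq_div, le_div_iff₀ hδ]
  linarith

end

end IncrementalVoting

/-! ### The main theorem -/

theorem mainTheorem8 :
    ∃ C : ℝ, 0 < C ∧
      ∀ (k : ℕ → ℕ) (x : ∀ n : ℕ, Fin n → ℤ),
        (fun n : ℕ => (k n : ℝ)) =o[atTop] (fun n : ℕ => (n : ℝ) / Real.log n ^ 2) →
        (∀ n v, 1 ≤ x n v ∧ x n v ≤ k n) →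
        -- (i), initial average strictly between `i` and `i + 1`
        (∀ i : ℕ → ℤ,
          (∀ᶠ n in atTop, (i n : ℝ) < IncrementalVoting.average (x n) ∧
            IncrementalVoting.average (x n) < i n + 1) →
          Tendsto (fun n => IncrementalVoting.winProb (x n) (i n) -
              (i n + 1 - IncrementalVoting.average (x n))) atTop (𝓝 0) ∧
          Tendsto (fun n => IncrementalVoting.winProb (x n) (i n + 1) -
              (IncrementalVoting.average (x n) - i n)) atTop (𝓝 0) ∧
          ((∃ δ : ℝ, 0 < δ ∧ ∀ᶠ n in atTop, δ ≤ i n + 1 - IncrementalVoting.average (x n)) →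
            (fun n => IncrementalVoting.winProb (x n) (i n)) ~[atTop]
              (fun n => i n + 1 - IncrementalVoting.average (x n))) ∧
          ((∃ δ : ℝ, 0 < δ ∧ ∀ᶠ n in atTop, δ ≤ IncrementalVoting.average (x n) - i n) →
            (fun n => IncrementalVoting.winProb (x n) (i n + 1)) ~[atTop]
              (fun n => IncrementalVoting.average (x n) - i n))) ∧
        -- (i), initial average asymptotically an integer `i`
        (∀ i : ℕ → ℤ,
          Tendsto (fun n => IncrementalVoting.average (x n) - i n) atTop (𝓝 0) →
          (fun n => IncrementalVoting.winProb (x n) (i n)) ~[atTop] (fun _ => (1 : ℝ))) ∧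
        -- (ii), at most three consecutive values remain after `O(n k log n)` steps w.h.p.
        Tendsto (fun n => (IncrementalVoting.completeLaw n).real
            {ω | ∃ t : ℕ, (t : ℝ) ≤ C * (n * k n * Real.log n) ∧
              IncrementalVoting.AtMostThreeConsecutive
                (IncrementalVoting.opinions (x n) ω t)}) atTop (𝓝 1) ∧
        -- (ii), the expected completion time is `O(n ^ 2)`
        (∀ᶠ n in atTop,
          ∫⁻ ω, IncrementalVoting.completionTime (x n) ω ∂IncrementalVoting.completeLaw n
            ≤ ENNReal.ofReal (C * (n : ℝ) ^ 2)) := by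
  -- The constant `9` comes from the completion time; the collapse to three values needs only `5`.
  refine ⟨9, by norm_num, fun k x hk hx => ⟨fun i hi => ?_, fun i hi => ?_,
    IncrementalVoting.tendsto_real_atMostThreeConsecutive hk hx, ?_⟩⟩
  · have h1 : Tendsto (fun n => IncrementalVoting.winProb (x n) (i n) -
        (i n + 1 - IncrementalVoting.average (x n))) atTop (𝓝 0) := by
      refine Metric.tendsto_nhds.2 fun ε hε => ?_
      filter_upwards [IncrementalVoting.eventually_abs_winProb_sub_le hk hx hε, hi] with n hn hin
      rw [Real.dist_0_eq_abs]
      exact (hn (i n) hin.1.le hin.2.le).1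
    have h2 : Tendsto (fun n => IncrementalVoting.winProb (x n) (i n + 1) -
        (IncrementalVoting.average (x n) - i n)) atTop (𝓝 0) := by
      refine Metric.tendsto_nhds.2 fun ε hε => ?_
      filter_upwards [IncrementalVoting.eventually_abs_winProb_sub_le hk hx hε, hi] with n hn hin
      rw [Real.dist_0_eq_abs]
      exact (hn (i n) hin.1.le hin.2.le).2
    exact ⟨h1, h2, IncrementalVoting.isEquivalent_of_tendsto_sub h1,
      IncrementalVoting.isEquivalent_of_tendsto_sub h2⟩
  · refine (isEquivalent_const_iff_tendsto one_ne_zero).2 ?_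
    refine Metric.tendsto_nhds.2 fun ε hε => ?_
    have hε' : 0 < min 1 (ε / 2) := lt_min one_pos (by positivity)
    filter_upwards [IncrementalVoting.eventually_abs_winProb_sub_le hk hx (half_pos hε),
      Metric.tendsto_nhds.1 hi _ hε'] with n hn hin
    rw [Real.dist_0_eq_abs, lt_min_iff, abs_lt, abs_lt] at hin
    rw [Real.dist_eq, abs_lt]
    -- The average may approach `i` from either side. Below `i`, the pair `i - 1`, `i` is used, with
    -- `i` as its upper member.
    rcases le_total (i n : ℝ) (IncrementalVoting.average (x n)) with h | h
    · have := abs_lt.1 (hn (i n) h (by linarith)).1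
      constructor <;> linarith
    · have := abs_lt.1 (hn (i n - 1) (by push_cast; linarith) (by push_cast; linarith)).2
      rw [sub_add_cancel] at this
      push_cast at this
      constructor <;> linarith
  · filter_upwards [IncrementalVoting.eventually_sum_not_consensus_le hk hx,
      eventually_ge_atTop 2] with n hsum hn
    exact IncrementalVoting.lintegral_completionTime_le hn hsum
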